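/- Monoids are commutative and cancellative. For a set $P$, let $\mathcal F(P)$ be the free abelian monoid with basis $P$. A homomorphism $\varphi\colon H\to\mathcal F(P)$ is a \emph{divisor theory} if $\varphi(a)\mid\varphi(b)$ implies $a\mid b$ for all $a,b\in H$, and every $p\in P$ is the greatest common divisor of $\varphi(X)$ for some finite non-empty $X\subset H$. A monoid having a divisor theory is a \emph{Krull monoid}; its \emph{class group} is $\mathcal C(\varphi)=\mathsf q(\mathcal F(P))/\mathsf q(\varphi(H))$, where $\mathsf q$ denotes quotient groups (it does not depend on $\varphi$ up to isomorphism), and $[p]$ denotes the class of $p\in P$. For a subset $G_0$ of an additive abelian group $G$, let $\mathcal B(G_0)\subset\mathcal F(G_0)$ be the submonoid of zero-sum sequences, that is, of all $g_1\cdots g_\ell$ with $g_1+\dots+g_\ell=0$. If $\varphi\colon H\to\mathcal F(P)$ is a divisor theory and $G_P=\{[p]\mid p\in P\}\subset\mathcal C(\varphi)$, the \emph{block homomorphism} $H\to\mathcal B(G_P)$ sends $a$ with $\varphi(a)=p_1\cdots p_\ell$ to $[p_1]\cdots[p_\ell]$; here $\mathcal C(\varphi)$ may be identified with an isomorphic group.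 A homomorphism $\theta\colon H\to B$ of atomic monoids is a \emph{transfer homomorphism} if $B=B^\times\theta(H)B^\times$, $\theta^{-1}(B^\times)=H^\times$, and whenever $\theta(u)=bc$ with $u\in H$ and $b,c\in B$, there are $v,w\in H$ and $\varepsilon\in B^\times$ with $u=vw$, $\theta(v)=b\varepsilon^{-1}$, $\theta(w)=\varepsilon c$. For a monoid $H$, let $\mathsf L(a)$ be the set of all $k$ such that $a$ is a product of $k$ atoms (and $\mathsf L(a)=\{0\}$ if $a$ is a unit), and $\mathcal L(H)=\{\mathsf L(a)\mid a\in H\}$. A factorization of $a$ is an element $z$ of the free abelian monoid $\mathsf Z(H)$ over the atoms of the reduced monoid $H_{\mathrm{red}}=H/H^\times$ whose product in $H_{\mathrm{red}}$ is $aH^\times$. The distance $\mathsf d(z,z')$ is $\max\{\ell,m\}$, where $\ell,m$ are the lengths of $z,z'$ after cancelling their common part. The catenary degree $\mathsf c(H)\in\mathbb N_0\cup\{\infty\}$ is the smallest $M$ such that, for every $a\in H$, any two factorizations of $a$ can be joined by a chain of factorizations of $a$ with successive distances at most $M$. $H$ is \emph{locally tame} if for every atom $u$ of $H_{\mathrm{red}}$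 there is $M\in\mathbb N_0$ such that, for every $a\in H$ having a factorization that contains $u$ and for every factorization $z$ of $a$, there is a factorization $z'$ of $a$ containing $u$ with $\mathsf d(z,z')\le M$. \textbf{Theorem.} Let $H$ be a Krull monoid with finitely generated class group. Then there exist a finitely generated abelian group $G^*$, a subset $G_0^*\subset G^*$ such that the inclusion $\mathcal B(G_0^*)\hookrightarrow\mathcal F(G_0^*)$ is a divisor theory, and a transfer homomorphism $\theta^*\colon H\to\mathcal B(G_0^*)$ which is a composition of (finitely many, at least one) block homomorphisms, such that moreover: \begin{enumerate} \item $\mathcal L(H)=\mathcal L(\mathcal B(G_0^*))$. \item $\mathsf c(\mathcal B(G_0^*))\le\mathsf c(H)\le\max\{\mathsf c(\mathcal B(G_0^*)),2\}$. \item $H$ is locally tame if and only if $\mathcal B(G_0^*)$ is locally tame. \end{enumerate} -/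

import Mathlib

universe u v w

namespace KrullTransfer

noncomputable section

/-! ### Free abelian monoids, divisor theories and class groups -/

/-- The free abelian monoid `𝓕(P)` with basis `P`, written multiplicatively. -/
abbrev FreeAb (P : Type u) : Type u := Multiplicative (Multiset P)

/-- The basis element of `𝓕(P)` given by `p`. -/
def gen {P : Type u} (p : P) : FreeAb P := Multiplicative.ofAdd {p}

/-- A monoid homomorphism `φ` is a divisor homomorphism if `φ a ∣ φ b` implies `a ∣ b`. -/
def IsDivisorHom {H : Type u} {D : Type v} [CommMonoid H] [CommMonoid D] (φ : H →* D) : Prop :=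
  ∀ a b : H, φ a ∣ φ b → a ∣ b

/-- `φ : H → 𝓕(P)` is a divisor theory: it is a divisor homomorphism and every `p ∈ P` is the
greatest common divisor of `φ(X)` for some finite non-empty `X ⊆ H`. -/
structure IsDivisorTheory {H : Type u} [CommMonoid H] {P : Type v} (φ : H →* FreeAb P) :
    Prop where
  divisorHom : IsDivisorHom φ
  gcd : ∀ p : P, ∃ X : Finset H, X.Nonempty ∧ (∀ x ∈ X, gen p ∣ φ x) ∧
    ∀ d : FreeAb P, (∀ x ∈ X, d ∣ φ x) → d ∣ gen p

/-- The class group `q(D) / q(φ(H))` of `φ : H → D`, written additively. -/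
abbrev ClassGrp {H : Type u} {D : Type v} [CommMonoid H] [CommMonoid D] (φ : H →* D) : Type v :=
  Additive (Algebra.GrothendieckGroup D ⧸
    Subgroup.closure (Algebra.GrothendieckGroup.of '' Set.range φ))

/-- The class `[a] ∈ 𝓒(φ)` of an element `a ∈ D`. -/
def cls {H : Type u} {D : Type v} [CommMonoid H] [CommMonoid D] (φ : H →* D) (a : D) :
    ClassGrp φ :=
  Additive.ofMul (QuotientGroup.mk (Algebra.GrothendieckGroup.of a))

/-! ### Monoids of zero-sum sequences and block homomorphisms -/

/-- The monoid `𝓑(G₀)` of zero-sum sequences over a subset `G₀` of an additive abelian group,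
as a submonoid of `𝓕(G₀)`. -/
def ZeroSum {G : Type u} [AddCommGroup G] (G₀ : Set G) : Submonoid (FreeAb G₀) where
  carrier := {S | ((Multiplicative.toAdd S).map Subtype.val).sum = 0}
  one_mem' := by simp
  mul_mem' {a b} ha hb := by
    change Multiset.sum _ = 0 at ha hb
    change Multiset.sum _ = 0
    simp [ha, hb]

/-- The underlying multiset of group elements of a zero-sum sequence. -/
def terms {G : Type u} [AddCommGroup G] {G₀ : Set G} (S : ZeroSum G₀) : Multiset G :=
  (Multiplicative.toAdd S.1).map Subtype.val

/-- `θ : H → 𝓑(G₀)` is the block homomorphism of `H`, for `G₀ ⊆ G`: there is a divisor theory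
`φ : H → 𝓕(P)` such that, after identifying the class group `𝓒(φ)` with `G` by an isomorphism
`e`, the set `G₀` is the set of classes containing prime divisors, and `θ a` arises from `φ a`
by replacing each prime divisor by its class. -/
def IsBlockHom {H : Type u} [CommMonoid H] {G : Type u} [AddCommGroup G] {G₀ : Set G}
    (θ : H →* ZeroSum G₀) : Prop :=
  ∃ (P : Type u) (φ : H →* FreeAb P) (e : ClassGrp φ ≃+ G),
    IsDivisorTheory φ ∧
    G₀ = Set.range (fun p : P => e (cls φ (gen p))) ∧
    ∀ a : H, terms (θ a) = (Multiplicative.toAdd (φ a)).map (fun p => e (cls φ (gen p)))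

/-- `θ : H → 𝓑(G₀)` is a composition of (finitely many, at least one) block homomorphisms
`H → 𝓑(G₁) → ⋯ → 𝓑(G₀)`. -/
inductive IsBlockComposition {H : Type u} [CommMonoid H] :
    ∀ {G : Type u} [AddCommGroup G] {G₀ : Set G}, (H →* ZeroSum G₀) → Prop
  | base {G : Type u} [AddCommGroup G] {G₀ : Set G} (θ : H →* ZeroSum G₀) :
      IsBlockHom θ → IsBlockComposition θ
  | step {G G' : Type u} [AddCommGroup G] [AddCommGroup G'] {G₀ : Set G} {G₀' : Set G'}
      (θ : H →* ZeroSum G₀) (η : ZeroSum G₀ →* ZeroSum G₀') :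
      IsBlockComposition θ → IsBlockHom η → IsBlockComposition (η.comp θ)

/-! ### Transfer homomorphisms -/

/-- Every non-unit is a finite product of atoms. -/
def AtomicMonoid (H : Type u) [CommMonoid H] : Prop :=
  ∀ a : H, ¬ IsUnit a → ∃ s : Multiset H, (∀ x ∈ s, Irreducible x) ∧ s.prod = a

/-- Transfer homomorphisms of (commutative, atomic) monoids. -/
structure IsTransferHom {H : Type u} {B : Type v} [CommMonoid H] [CommMonoid B] (θ : H →* B) :
    Prop where
  atomic_left : AtomicMonoid H
  atomic_right : AtomicMonoid B
  surj : ∀ b : B, ∃ (ε η : Bˣ) (a : H), b = ε * θ a * η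
  isUnit_iff : ∀ a : H, IsUnit (θ a) ↔ IsUnit a
  lift : ∀ (a : H) (b c : B), θ a = b * c →
    ∃ (x y : H) (ε : Bˣ), a = x * y ∧ θ x = b * (ε⁻¹ : Bˣ) ∧ θ y = ε * c

/-! ### Sets of lengths, factorizations, catenary degree and tameness -/

/-- The set of lengths `L(a)`, with `L(a) = {0}` for units. -/
def lengths {H : Type u} [CommMonoid H] (a : H) : Set ℕ :=
  {k | (IsUnit a ∧ k = 0) ∨
    (¬ IsUnit a ∧ ∃ s : Multiset H, (∀ x ∈ s, Irreducible x) ∧ s.prod = a ∧ s.card = k)}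

/-- The system of sets of lengths `𝓛(H)`. -/
def lengthSystem (H : Type u) [CommMonoid H] : Set (Set ℕ) := Set.range (lengths (H := H))

/-- The set of atoms of the associated reduced monoid `H_red`. -/
abbrev RedAtom (H : Type u) [CommMonoid H] : Type u := {x : Associates H // Irreducible x}

/-- The set `Z(a)` of factorizations of `a`, inside the free abelian monoid over the atoms of
`H_red`. -/
def factorizations {H : Type u} [CommMonoid H] (a : H) : Set (Multiset (RedAtom H)) :=
  {z | (z.map Subtype.val).prod = Associates.mk a}

open Classical in
/-- The distance of two factorizations: cancel the common part (with multiplicity) and take the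
maximum of the lengths of the remaining parts. -/
def fdist {A : Type u} (z z' : Multiset A) : ℕ := max (z - z').card (z' - z).card

/-- `z` and `z'` can be joined by an `M`-chain of factorizations of `a`. -/
def Chained {H : Type u} [CommMonoid H] (a : H) (M : ℕ∞) (z z' : Multiset (RedAtom H)) : Prop :=
  Relation.ReflTransGen
    (fun x y => x ∈ factorizations a ∧ y ∈ factorizations a ∧ (fdist x y : ℕ∞) ≤ M) z z'

/-- The catenary degree `c(a)` of an element. -/
def catenaryDeg {H : Type u} [CommMonoid H] (a : H) : ℕ∞ :=
  sInf {M : ℕ∞ | ∀ z ∈ factorizations a, ∀ z' ∈ factorizations a, Chained a M z z'}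

/-- The catenary degree `c(H)` of a monoid. -/
def catenaryDegree (H : Type u) [CommMonoid H] : ℕ∞ := ⨆ a : H, catenaryDeg a

/-- The local tame degree `t(H, u)` of an atom `u` of `H_red`. -/
def tameDegree {H : Type u} [CommMonoid H] (x : RedAtom H) : ℕ∞ :=
  sInf {M : ℕ∞ | ∀ a : H, (∃ y ∈ factorizations a, x ∈ y) → ∀ z ∈ factorizations a,
    ∃ z' ∈ factorizations a, x ∈ z' ∧ (fdist z z' : ℕ∞) ≤ M}

/-- `H` is locally tame. -/
def LocallyTame (H : Type u) [CommMonoid H] : Prop := ∀ x : RedAtom H, tameDegree x < ⊤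

end

end KrullTransfer

open KrullTransfer

namespace KrullTransfer

noncomputable section

/-! ### Multisets -/

/-! The proof joins a comparison of arithmetic with a termination argument.

Arithmetic. A block homomorphism forgets which prime of a class occurs, and every multiset of primes
whose classes sum to zero comes from `H`. Hence splittings of blocks lift, the map is a transfer
homomorphism, and factorizations lift without increasing distances. This gives equal length systems,
one catenary inequality and one direction of tameness. For the converses, factorizations with the
same image are compared by swapping primes of equal class between two atoms (`exists_exchange`).
Each swap has distance at most 2, which explains the 2 in the catenary bound. The number of swaps
needed to produce a given atom is at most the number of its primes, which bounds tameness. All of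
this survives composition (`ControlsArithmetic.comp`).

Termination. The inclusion of zero-sum sequences into the free monoid is a divisor homomorphism but
perhaps not a divisor theory; then block homomorphisms are iterated. Progress is measured by the
number of primes, with multiplicity, of an ample element. One exists because a finitely generated
group is finitely generated as a monoid (`IsDivisorTheory.exists_isAmple`). If a divisor
homomorphism with an ample element is not a divisor theory, then either some prime `q` always forces
another prime `p`, or the values at some `p` have a common factor `n > 1`. Dropping `p`, or dividing
by `n`, keeps the divisor property and ampleness, and strictly shortens the ample element because
`p` occurs in it (`IsAmple.exists_card_lt`). Block homomorphisms preserve both ampleness and this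
length, so the iteration stops. Ampleness also makes each new class group finitely generated
(`IsAmple.fg`). -/

lemma fdist_map_le {A : Type*} {C : Type*} (g : A → C) (z z' : Multiset A) :
    fdist (z.map g) (z'.map g) ≤ fdist z z' := by
  classical
  have key : ∀ s t : Multiset A, (s.map g - t.map g).card ≤ (s - t).card := by
    intro s t
    rw [← Multiset.card_map g (s - t)]
    apply Multiset.card_le_card
    rw [tsub_le_iff_left, ← Multiset.map_add]
    exact Multiset.map_le_map le_add_tsub
  unfold fdist
  convert max_le_max (key z z') (key z' z)

lemma fdist_triangle {A : Type*} (x y z : Multiset A) :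
    fdist x z ≤ fdist x y + fdist y z := by
  classical
  have key : ∀ s t r : Multiset A, (s - r).card ≤ (s - t).card + (t - r).card := by
    intro s t r
    rw [← Multiset.card_add]
    exact Multiset.card_le_card (tsub_le_tsub_add_tsub)
  unfold fdist
  have h1 := key x y z
  have h2 := key z y x
  refine max_le ?_ ?_
  · exact le_trans (by convert h1) (add_le_add (le_max_left _ _) (le_max_left _ _))
  · rw [add_comm]
    exact le_trans (by convert h2) (add_le_add (le_max_right _ _) (le_max_right _ _))

lemma fdist_add_left {A : Type*} (x y z : Multiset A) :
    fdist (x + y) (x + z) = fdist y z := by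
  classical
  unfold fdist
  simp only [add_tsub_add_eq_tsub_left]

lemma fdist_le_card {A : Type*} (x y : Multiset A) : fdist x y ≤ max x.card y.card := by
  classical
  unfold fdist
  exact max_le_max (Multiset.card_le_card tsub_le_self) (Multiset.card_le_card tsub_le_self)

lemma fdist_self {A : Type*} (x : Multiset A) : fdist x x = 0 := by
  simp [fdist]

/-- Serves both to lift splittings of blocks to splittings of divisors and to isolate the part of a
factorization lying over a common part. -/
lemma exists_add_of_map_eq_add {A : Type*} {C : Type*} (g : A → C) (s t : Multiset C) :
    ∀ z : Multiset A, z.map g = s + t → ∃ x y, z = x + y ∧ x.map g = s ∧ y.map g = t := by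
  classical
  induction s using Multiset.induction with
  | empty => exact fun z h => ⟨0, z, by simp, by simp, by simpa using h⟩
  | cons a s ih =>
    intro z h
    rw [Multiset.cons_add, ← Multiset.map_eq_cons] at h
    obtain ⟨b, hb, rfl, h⟩ := h
    obtain ⟨x, y, hz, hx, hy⟩ := ih _ h
    refine ⟨b ::ₘ x, y, ?_, by simp [hx], hy⟩
    rw [Multiset.cons_add, ← hz, Multiset.cons_erase hb]

/-! ### Reduced monoids -/

instance associatesIsCancelMul {H : Type*} [CommMonoid H] [IsCancelMul H] :
    IsCancelMul (Associates H) := by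
  have : IsLeftCancelMul (Associates H) := by
    refine ⟨fun a b c h => ?_⟩
    induction a using Quotient.inductionOn with | _ a
    induction b using Quotient.inductionOn with | _ b
    induction c using Quotient.inductionOn with | _ c
    simp only [Associates.quotient_mk_eq_mk] at h ⊢
    have h' : Associates.mk (a * b) = Associates.mk (a * c) := h
    rw [Associates.mk_eq_mk_iff_associated] at h' ⊢
    obtain ⟨e, he⟩ := h'
    exact ⟨e, mul_left_cancel (a := a) (by rw [← mul_assoc, he])⟩
  exact CommMagma.IsLeftCancelMul.toIsCancelMul _

/-- The homomorphism of reduced monoids induced by a monoid homomorphism. -/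
def redMap {H : Type u} {B : Type v} [CommMonoid H] [CommMonoid B] (θ : H →* B) :
    Associates H →* Associates B where
  toFun := Quotient.map θ fun _ _ h => h.map θ
  map_one' := by
    change Associates.mk (θ 1) = Associates.mk 1
    rw [map_one]
  map_mul' := by
    rintro ⟨a⟩ ⟨b⟩
    change Associates.mk (θ (a * b)) = Associates.mk (θ a * θ b)
    rw [map_mul]

@[simp] lemma redMap_mk {H : Type u} {B : Type v} [CommMonoid H] [CommMonoid B] (θ : H →* B)
    (a : H) : redMap θ (Associates.mk a) = Associates.mk (θ a) := rfl

/-- A transfer homomorphism of reduced monoids, without any assumption on atomicity. -/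
structure IsReducedTransfer {A : Type u} {C : Type v} [CommMonoid A] [CommMonoid C]
    (f : A →* C) : Prop where
  surj : Function.Surjective f
  eq_one : ∀ a, f a = 1 → a = 1
  lift : ∀ a b c, f a = b * c → ∃ x y, a = x * y ∧ f x = b ∧ f y = c

lemma IsTransferHom.isReducedTransfer {H : Type u} {B : Type v} [CommMonoid H] [CommMonoid B]
    [Subsingleton Bˣ] {θ : H →* B} (hθ : IsTransferHom θ) : IsReducedTransfer (redMap θ) where
  surj b := by
    obtain ⟨b, rfl⟩ := Associates.exists_rep b
    obtain ⟨ε, η, a, h⟩ := hθ.surj b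
    refine ⟨Associates.mk a, ?_⟩
    rw [Subsingleton.elim ε 1, Subsingleton.elim η 1] at h
    simp [h]
  eq_one a h := by
    obtain ⟨a, rfl⟩ := Associates.exists_rep a
    rw [redMap_mk, Associates.mk_eq_one, hθ.isUnit_iff] at h
    exact Associates.mk_eq_one.2 h
  lift a b c h := by
    obtain ⟨a, rfl⟩ := Associates.exists_rep a
    obtain ⟨b, rfl⟩ := Associates.exists_rep b
    obtain ⟨c, rfl⟩ := Associates.exists_rep c
    rw [redMap_mk, Associates.mk_mul_mk] at h
    obtain ⟨x, y, ε, rfl, h2, h3⟩ := hθ.lift a b c (Associates.mk_injective h)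
    rw [Subsingleton.elim ε 1] at h2 h3
    exact ⟨Associates.mk x, Associates.mk y, rfl, by simp [h2], by simp [h3]⟩

lemma IsTransferHom.surjective {H : Type u} {B : Type v} [CommMonoid H] [CommMonoid B]
    [Subsingleton Bˣ] {θ : H →* B} (hθ : IsTransferHom θ) : Function.Surjective θ := by
  intro b
  obtain ⟨ε, η, a, h⟩ := hθ.surj b
  rw [Subsingleton.elim ε 1, Subsingleton.elim η 1] at h
  exact ⟨a, by simp [h]⟩

lemma IsTransferHom.comp {H : Type u} {B : Type v} {C : Type w} [CommMonoid H] [CommMonoid B]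
    [CommMonoid C] [Subsingleton Bˣ] [Subsingleton Cˣ] {θ : H →* B} {η : B →* C}
    (hη : IsTransferHom η) (hθ : IsTransferHom θ) : IsTransferHom (η.comp θ) where
  atomic_left := hθ.atomic_left
  atomic_right := hη.atomic_right
  surj c := by
    obtain ⟨a, rfl⟩ := (hη.surjective.comp hθ.surjective) c
    exact ⟨1, 1, a, by simp⟩
  isUnit_iff a := (hη.isUnit_iff _).trans (hθ.isUnit_iff a)
  lift a b c h := by
    obtain ⟨x, y, ε, hxy, h2, h3⟩ := hη.lift (θ a) b c h
    obtain ⟨x', y', ε', hxy', h2', h3'⟩ := hθ.lift a x y hxy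
    refine ⟨x', y', ε, hxy', ?_, ?_⟩
    · rw [Subsingleton.elim ε' 1] at h2'
      simpa [h2'] using h2
    · rw [Subsingleton.elim ε' 1] at h3'
      simpa [h3'] using h3

/-! ### Lifting factorizations and chains along reduced transfer homomorphisms -/

section Reduced

variable {H : Type u} {B : Type v} [CommMonoid H] [CommMonoid B]
  {f : Associates H →* Associates B}

lemma IsReducedTransfer.eq_one_iff (hf : IsReducedTransfer f) (a : Associates H) :
    f a = 1 ↔ a = 1 :=
  ⟨hf.eq_one a, fun h => by rw [h, map_one]⟩

lemma IsReducedTransfer.irreducible_iff (hf : IsReducedTransfer f) (a : Associates H) :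
    Irreducible (f a) ↔ Irreducible a := by
  rw [_root_.irreducible_iff, _root_.irreducible_iff]
  simp only [Associates.isUnit_iff_eq_one, hf.eq_one_iff]
  refine and_congr_right fun _ => ⟨fun h b c hbc => ?_, fun h b c hbc => ?_⟩
  · have := h (a := f b) (b := f c) (by rw [hbc, map_mul])
    rwa [hf.eq_one_iff, hf.eq_one_iff] at this
  · obtain ⟨x, y, hxy, rfl, rfl⟩ := hf.lift a b c hbc
    rw [hf.eq_one_iff, hf.eq_one_iff]
    exact h hxy

/-- The map on atoms induced by a reduced transfer homomorphism. -/
def IsReducedTransfer.atomMap (hf : IsReducedTransfer f) (x : RedAtom H) : RedAtom B :=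
  ⟨f x, (hf.irreducible_iff _).2 x.2⟩

/-- The factorizations of an element of the reduced monoid. -/
def redFactorizations (x : Associates H) : Set (Multiset (RedAtom H)) :=
  {z | (z.map Subtype.val).prod = x}

lemma mem_redFactorizations {x : Associates H} {z : Multiset (RedAtom H)} :
    z ∈ redFactorizations x ↔ (z.map Subtype.val).prod = x := Iff.rfl

lemma prod_map_atomMap (hf : IsReducedTransfer f) (z : Multiset (RedAtom H)) :
    ((z.map hf.atomMap).map Subtype.val).prod = f (z.map Subtype.val).prod := by
  rw [map_multiset_prod, Multiset.map_map, Multiset.map_map]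
  rfl

lemma map_atomMap_mem (hf : IsReducedTransfer f) {x : Associates H} {z : Multiset (RedAtom H)}
    (hz : z ∈ redFactorizations x) : z.map hf.atomMap ∈ redFactorizations (f x) := by
  rw [mem_redFactorizations] at hz ⊢
  rw [prod_map_atomMap, hz]

lemma exists_lift_factorization (hf : IsReducedTransfer f) (y : Multiset (RedAtom B)) :
    ∀ x : Associates H, y ∈ redFactorizations (f x) →
      ∃ z ∈ redFactorizations x, z.map hf.atomMap = y := by
  induction y using Multiset.induction with
  | empty =>
    intro x hx
    refine ⟨0, ?_, rfl⟩
    simp only [mem_redFactorizations, Multiset.map_zero, Multiset.prod_zero] at hx ⊢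
    exact (hf.eq_one _ hx.symm).symm
  | cons b y ih =>
    intro x hx
    simp only [mem_redFactorizations, Multiset.map_cons, Multiset.prod_cons] at hx
    obtain ⟨p, q, rfl, hp, hq⟩ := hf.lift x _ _ hx.symm
    obtain ⟨z, hz, rfl⟩ := ih q hq.symm
    have hirr : Irreducible p := by
      rw [← hf.irreducible_iff, hp]
      exact b.2
    refine ⟨⟨p, hirr⟩ ::ₘ z, ?_, ?_⟩
    · rw [mem_redFactorizations] at hz ⊢
      simp [hz]
    · rw [Multiset.map_cons]
      congr 1
      exact Subtype.ext hp

/-- Only the part of `z` lying over what the two image factorizations do not share is lifted anew;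
cancellation in the target shows that the rest of `y` factors the image of that part. The unshared
parts upstairs then have the same lengths as those downstairs. -/
lemma exists_lift_factorization_fdist_le [IsCancelMul B] (hf : IsReducedTransfer f)
    {x : Associates H} {z : Multiset (RedAtom H)} (hz : z ∈ redFactorizations x)
    {y : Multiset (RedAtom B)} (hy : y ∈ redFactorizations (f x)) :
    ∃ z' ∈ redFactorizations x, z'.map hf.atomMap = y ∧
      fdist z z' ≤ fdist (z.map hf.atomMap) y := by
  classical
  set s := z.map hf.atomMap with hs
  have h1 : s = s ∩ y + (s - y) := by
    ext a
    simp only [Multiset.count_add, Multiset.count_inter, Multiset.count_sub]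
    omega
  have h2 : y = s ∩ y + (y - s) := by
    ext a
    simp only [Multiset.count_add, Multiset.count_inter, Multiset.count_sub]
    omega
  obtain ⟨zg, zw, rfl, hzg, hzw⟩ := exists_add_of_map_eq_add hf.atomMap _ _ z (hs.symm.trans h1)
  have h3 : (y - s) ∈ redFactorizations (f (zw.map Subtype.val).prod) := by
    rw [mem_redFactorizations, ← prod_map_atomMap hf, hzw]
    have h4 := (map_atomMap_mem hf hz)
    rw [← hs, mem_redFactorizations, ← mem_redFactorizations.1 hy] at h4
    replace h4 : ((s ∩ y + (s - y)).map Subtype.val).prod =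
        ((s ∩ y + (y - s)).map Subtype.val).prod := by
      rw [← h1, ← h2, h4]
    rw [Multiset.map_add, Multiset.map_add, Multiset.prod_add, Multiset.prod_add] at h4
    exact (mul_left_cancel h4).symm
  obtain ⟨zw', hzw', hmap⟩ := exists_lift_factorization hf _ _ h3
  refine ⟨zg + zw', ?_, ?_, ?_⟩
  · rw [mem_redFactorizations] at hz hzw' ⊢
    rw [Multiset.map_add, Multiset.prod_add, hzw', ← hz, Multiset.map_add, Multiset.prod_add]
  · rw [Multiset.map_add, hzg, hmap, ← h2]
  · rw [fdist_add_left]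
    refine (fdist_le_card _ _).trans ?_
    rw [← Multiset.card_map hf.atomMap zw, ← Multiset.card_map hf.atomMap zw', hzw, hmap]
    unfold fdist
    apply le_of_eq
    congr!

/-- `z` and `z'` can be joined by an `M`-chain of factorizations of `x`. -/
def RedChained (x : Associates H) (M : ℕ∞) (z z' : Multiset (RedAtom H)) : Prop :=
  Relation.ReflTransGen
    (fun s t => s ∈ redFactorizations x ∧ t ∈ redFactorizations x ∧ (fdist s t : ℕ∞) ≤ M) z z'

lemma RedChained.mono {x : Associates H} {M N : ℕ∞} (hMN : M ≤ N) {z z' : Multiset (RedAtom H)}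
    (h : RedChained x M z z') : RedChained x N z z' :=
  Relation.ReflTransGen.mono (fun _ _ h => ⟨h.1, h.2.1, h.2.2.trans hMN⟩) _ _ h

lemma RedChained.map (hf : IsReducedTransfer f) {x : Associates H} {M : ℕ∞}
    {z z' : Multiset (RedAtom H)} (h : RedChained x M z z') :
    RedChained (f x) M (z.map hf.atomMap) (z'.map hf.atomMap) :=
  Relation.ReflTransGen.lift _ (fun _ _ h => ⟨map_atomMap_mem hf h.1, map_atomMap_mem hf h.2.1,
    (Nat.cast_le.2 (fdist_map_le _ _ _)).trans h.2.2⟩) _ _ h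

lemma RedChained.add_left {x y : Associates H} {M : ℕ∞} {s z z' : Multiset (RedAtom H)}
    (hs : s ∈ redFactorizations y) (h : RedChained x M z z') :
    RedChained (y * x) M (s + z) (s + z') := by
  refine Relation.ReflTransGen.lift _ (fun a b h => ⟨?_, ?_, ?_⟩) _ _ h
  · rw [mem_redFactorizations, Multiset.map_add, Multiset.prod_add, hs, h.1]
  · rw [mem_redFactorizations, Multiset.map_add, Multiset.prod_add, hs, h.2.1]
  · rw [fdist_add_left]
    exact h.2.2

lemma RedChained.exists_lift [IsCancelMul B] (hf : IsReducedTransfer f) {x : Associates H}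
    {M : ℕ∞} {y y' : Multiset (RedAtom B)} (h : RedChained (f x) M y y')
    {z : Multiset (RedAtom H)} (hz : z ∈ redFactorizations x) (hy : z.map hf.atomMap = y) :
    ∃ z' ∈ redFactorizations x, z'.map hf.atomMap = y' ∧ RedChained x M z z' := by
  induction h with
  | refl => exact ⟨z, hz, hy, Relation.ReflTransGen.refl⟩
  | tail _ hs ih =>
    obtain ⟨z₁, hz₁, rfl, hc⟩ := ih
    obtain ⟨z₂, hz₂, rfl, hd⟩ := exists_lift_factorization_fdist_le hf hz₁ hs.2.1
    exact ⟨z₂, hz₂, rfl, hc.tail ⟨hz₁, hz₂, (Nat.cast_le.2 hd).trans hs.2.2⟩⟩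

end Reduced

/-! ### Arithmetic invariants under transfer homomorphisms -/

lemma irreducible_associatesMk_iff {H : Type u} [CommMonoid H] (a : H) :
    Irreducible (Associates.mk a) ↔ Irreducible a := by
  rw [_root_.irreducible_iff, _root_.irreducible_iff, Associates.isUnit_mk]
  refine and_congr_right fun _ => ⟨fun h b c hbc => ?_, fun h b c hbc => ?_⟩
  · rw [← Associates.isUnit_mk (a := b), ← Associates.isUnit_mk (a := c)]
    exact h (by rw [hbc, Associates.mk_mul_mk])
  · obtain ⟨b, rfl⟩ := Associates.exists_rep b
    obtain ⟨c, rfl⟩ := Associates.exists_rep c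
    rw [Associates.mk_mul_mk, Associates.mk_eq_mk_iff_associated] at hbc
    obtain ⟨e, he⟩ := hbc.symm
    rw [Associates.isUnit_mk, Associates.isUnit_mk]
    simpa using h (a := b) (b := c * e) (by rw [← he, mul_assoc])

lemma exists_multiset_of_factorization {H : Type u} [CommMonoid H] {a : H} (ha : ¬ IsUnit a)
    {z : Multiset (RedAtom H)} (hz : z ∈ factorizations a) :
    ∃ s : Multiset H, (∀ x ∈ s, Irreducible x) ∧ s.prod = a ∧ s.card = z.card := by
  obtain ⟨t, ht⟩ : ∃ t : Multiset H, t.map Associates.mk = z.map Subtype.val :=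
    ⟨z.map fun x => x.1.exists_rep.choose, by
      rw [Multiset.map_map]
      exact Multiset.map_congr rfl fun x _ => x.1.exists_rep.choose_spec⟩
  have hirr : ∀ x ∈ t, Irreducible x := by
    intro x hx
    have h1 := Multiset.mem_map_of_mem Associates.mk hx
    rw [ht, Multiset.mem_map] at h1
    obtain ⟨y, -, hy⟩ := h1
    rw [← irreducible_associatesMk_iff, ← hy]
    exact y.2
  have hcard : t.card = z.card := by
    rw [← Multiset.card_map Associates.mk t, ht, Multiset.card_map]
  have hprod : Associates.mk t.prod = Associates.mk a := by
    rw [← Associates.prod_mk, ht]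
    exact hz
  obtain ⟨e, he⟩ := Associates.mk_eq_mk_iff_associated.1 hprod
  rcases t.empty_or_exists_mem with rfl | ⟨b, hb⟩
  · exact absurd (by rw [← he]; simp) ha
  · obtain ⟨t, rfl⟩ := Multiset.exists_cons_of_mem hb
    -- The product of representatives is correct only up to a unit, which is absorbed into one atom;
    -- there is one because `a` is not a unit.
    refine ⟨(b * e) ::ₘ t, ?_, ?_, by simpa using hcard⟩
    · intro x hx
      rcases Multiset.mem_cons.1 hx with rfl | hx
      · exact (irreducible_mul_units e).2 (hirr b (by simp))
      · exact hirr x (by simp [hx])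
    · rw [← he, Multiset.prod_cons, Multiset.prod_cons]
      exact mul_right_comm _ _ _

lemma lengths_eq_card_factorizations {H : Type u} [CommMonoid H] (a : H) :
    lengths a = {k | ∃ z ∈ factorizations a, z.card = k} := by
  ext k
  simp only [lengths, Set.mem_ofPred_eq]
  constructor
  · rintro (⟨ha, rfl⟩ | ⟨-, s, hs, rfl, rfl⟩)
    · refine ⟨0, ?_, rfl⟩
      simpa [factorizations, eq_comm] using Associates.mk_eq_one.2 ha
    · refine ⟨s.attach.map fun x =>
        ⟨Associates.mk x.1, (irreducible_associatesMk_iff _).2 (hs _ x.2)⟩,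
        ?_, by simp⟩
      simp only [factorizations, Set.mem_ofPred_eq, Multiset.map_map, Function.comp_def]
      rw [← Associates.prod_mk, ← Multiset.attach_map_val' s Associates.mk]
  · rintro ⟨z, hz, rfl⟩
    by_cases ha : IsUnit a
    · refine Or.inl ⟨ha, ?_⟩
      by_contra hne
      obtain ⟨x, hx⟩ := Multiset.card_pos_iff_exists_mem.1 (Nat.pos_of_ne_zero hne)
      have h1 : x.1 ∣ 1 := by
        rw [← Associates.mk_eq_one.2 ha, ← show _ = Associates.mk a from hz]
        exact Multiset.dvd_prod (Multiset.mem_map_of_mem _ hx)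
      exact x.2.not_isUnit (isUnit_of_dvd_one h1)
    · exact Or.inr ⟨ha, exists_multiset_of_factorization ha hz⟩

section Transfer

variable {H : Type u} {B : Type v} [CommMonoid H] [CommMonoid B] [Subsingleton Bˣ]
  {θ : H →* B}

lemma IsTransferHom.lengths_map (hθ : IsTransferHom θ) (a : H) : lengths (θ a) = lengths a := by
  have hf := hθ.isReducedTransfer
  rw [lengths_eq_card_factorizations, lengths_eq_card_factorizations]
  ext k
  constructor
  · rintro ⟨y, hy, rfl⟩
    obtain ⟨z, hz, rfl⟩ := exists_lift_factorization hf y (Associates.mk a) hy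
    exact ⟨z, hz, by simp⟩
  · rintro ⟨z, hz, rfl⟩
    exact ⟨z.map hf.atomMap, map_atomMap_mem hf hz, by simp⟩

lemma IsTransferHom.lengthSystem_eq (hθ : IsTransferHom θ) : lengthSystem H = lengthSystem B := by
  unfold lengthSystem
  rw [← hθ.surjective.range_comp]
  congr 1
  exact funext fun a => (hθ.lengths_map a).symm

lemma chained_top {H : Type u} [CommMonoid H] {a : H} {z z' : Multiset (RedAtom H)}
    (hz : z ∈ factorizations a) (hz' : z' ∈ factorizations a) : Chained a ⊤ z z' :=
  Relation.ReflTransGen.single ⟨hz, hz', le_top⟩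

lemma chained_catenaryDeg {H : Type u} [CommMonoid H] {a : H} {z z' : Multiset (RedAtom H)}
    (hz : z ∈ factorizations a) (hz' : z' ∈ factorizations a) :
    Chained a (catenaryDeg a) z z' :=
  csInf_mem (s := {M : ℕ∞ | ∀ z ∈ factorizations a, ∀ z' ∈ factorizations a, Chained a M z z'})
    ⟨⊤, fun _ h _ h' => chained_top h h'⟩ z hz z' hz'

lemma IsTransferHom.catenaryDegree_le (hθ : IsTransferHom θ) :
    catenaryDegree B ≤ catenaryDegree H := by
  have hf := hθ.isReducedTransfer
  refine iSup_le fun b => ?_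
  obtain ⟨a, rfl⟩ := hθ.surjective b
  refine le_trans ?_ (le_iSup (fun a : H => catenaryDeg a) a)
  refine sInf_le fun y hy y' hy' => ?_
  obtain ⟨z, hz, rfl⟩ := exists_lift_factorization hf y (Associates.mk a) hy
  obtain ⟨z', hz', rfl⟩ := exists_lift_factorization hf y' (Associates.mk a) hy'
  exact RedChained.map hf (chained_catenaryDeg hz hz')

/-- The divisibility `x.1 ∣ a` follows from the factorization containing `x`; it is recorded because
the exchange argument needs exactly this. -/
lemma locallyTame_iff {H : Type u} [CommMonoid H] : LocallyTame H ↔ ∀ x : RedAtom H, ∃ M : ℕ,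
    ∀ a : Associates H, x.1 ∣ a → (∃ y ∈ redFactorizations a, x ∈ y) →
      ∀ z ∈ redFactorizations a, ∃ z' ∈ redFactorizations a, x ∈ z' ∧ fdist z z' ≤ M := by
  refine forall_congr' fun x => ?_
  unfold tameDegree
  rw [sInf_lt_iff]
  constructor
  · rintro ⟨M, hM, hlt⟩
    lift M to ℕ using hlt.ne
    refine ⟨M, fun a _ h z hz => ?_⟩
    obtain ⟨a, rfl⟩ := Associates.exists_rep a
    obtain ⟨z', h1, h2, h3⟩ := hM a h z hz
    exact ⟨z', h1, h2, by exact_mod_cast h3⟩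
  · rintro ⟨M, hM⟩
    refine ⟨M, fun a h z hz => ?_, ENat.natCast_lt_top M⟩
    obtain ⟨y, hy, hxy⟩ := h
    have hdvd : x.1 ∣ Associates.mk a := by
      rw [← show _ = Associates.mk a from hy]
      exact Multiset.dvd_prod (Multiset.mem_map_of_mem _ hxy)
    obtain ⟨z', h1, h2, h3⟩ := hM (Associates.mk a) hdvd ⟨y, hy, hxy⟩ z hz
    exact ⟨z', h1, h2, by exact_mod_cast h3⟩

lemma IsTransferHom.locallyTame (hθ : IsTransferHom θ) (h : LocallyTame H) : LocallyTame B := by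
  classical
  have hf := hθ.isReducedTransfer
  rw [locallyTame_iff] at h ⊢
  intro x
  obtain ⟨u, hu⟩ := hf.surj x.1
  have huirr : Irreducible u := by
    rw [← hf.irreducible_iff, hu]
    exact x.2
  have hux : hf.atomMap ⟨u, huirr⟩ = x := Subtype.ext hu
  obtain ⟨M, hM⟩ := h ⟨u, huirr⟩
  refine ⟨M, fun b _ ⟨y₀, hy₀, hxy₀⟩ y hy => ?_⟩
  -- An arbitrary preimage of `b` need not be divisible by `u`, so the preimage is built as `u *
  -- a'`, with `a'` over the product of the other atoms.
  obtain ⟨y₁, rfl⟩ := Multiset.exists_cons_of_mem hxy₀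
  obtain ⟨a', ha'⟩ := hf.surj (y₁.map Subtype.val).prod
  have hb : b = redMap θ (u * a') := by
    rw [map_mul, hu, ha', ← mem_redFactorizations.1 hy₀, Multiset.map_cons, Multiset.prod_cons]
  subst hb
  obtain ⟨z₁, hz₁, -⟩ := exists_lift_factorization hf y₁ a' ha'.symm
  obtain ⟨z, hz, rfl⟩ := exists_lift_factorization hf y _ hy
  obtain ⟨z', hz', hu', hd⟩ := hM (u * a') (dvd_mul_right _ _) ⟨⟨u, huirr⟩ ::ₘ z₁, by
    rw [mem_redFactorizations] at hz₁ ⊢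
    simp [hz₁], by simp⟩ z hz
  refine ⟨z'.map hf.atomMap, map_atomMap_mem hf hz', ?_, (fdist_map_le _ _ _).trans hd⟩
  rw [← hux]
  exact Multiset.mem_map_of_mem _ hu'

end Transfer

/-! ### Free abelian monoids and zero-sum sequences -/

lemma freeAb_dvd_iff {P : Type u} {x y : FreeAb P} :
    x ∣ y ↔ Multiplicative.toAdd x ≤ Multiplicative.toAdd y := by
  rw [Multiset.le_iff_exists_add]
  exact Iff.rfl

lemma freeAb_isUnit_iff {P : Type u} {x : FreeAb P} : IsUnit x ↔ x = 1 := by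
  refine ⟨fun h => ?_, fun h => h ▸ isUnit_one⟩
  exact le_antisymm (α := Multiset P) (freeAb_dvd_iff.1 (isUnit_iff_dvd_one.1 h))
    (Multiset.zero_le _)

section ZeroSum

variable {G : Type u} [AddCommGroup G] {G₀ : Set G}

lemma terms_injective : Function.Injective (terms (G₀ := G₀)) := fun _ _ h =>
  Subtype.ext (Multiset.map_injective Subtype.val_injective h)

@[simp] lemma terms_one : terms (1 : ZeroSum G₀) = 0 := rfl

@[simp] lemma terms_mul (S T : ZeroSum G₀) : terms (S * T) = terms S + terms T :=
  Multiset.map_add _ _ _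

lemma sum_terms (S : ZeroSum G₀) : (terms S).sum = 0 := S.2

lemma mem_of_mem_terms {S : ZeroSum G₀} {g : G} (hg : g ∈ terms S) : g ∈ G₀ := by
  obtain ⟨x, -, rfl⟩ := Multiset.mem_map.1 hg
  exact x.2

lemma zeroSum_isUnit_iff {S : ZeroSum G₀} : IsUnit S ↔ S = 1 := by
  refine ⟨fun h => ?_, fun h => h ▸ isUnit_one⟩
  exact Subtype.ext (freeAb_isUnit_iff.1 (h.map (ZeroSum G₀).subtype))

instance : Subsingleton (ZeroSum G₀)ˣ :=
  ⟨fun a b => Units.ext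
    ((zeroSum_isUnit_iff.1 a.isUnit).trans (zeroSum_isUnit_iff.1 b.isUnit).symm)⟩

lemma isDivisorHom_subtype : IsDivisorHom (ZeroSum G₀).subtype := by
  rintro a b ⟨c, hc⟩
  have hc' : (b : FreeAb G₀) = a * c := hc
  have hmem : c ∈ ZeroSum G₀ := by
    have h1 : ((Multiplicative.toAdd (b : FreeAb G₀)).map Subtype.val).sum = 0 := b.2
    have h2 : ((Multiplicative.toAdd (a : FreeAb G₀)).map Subtype.val).sum = 0 := a.2
    change ((Multiplicative.toAdd c).map Subtype.val).sum = 0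
    rw [hc', toAdd_mul, Multiset.map_add, Multiset.sum_add, h2, zero_add] at h1
    exact h1
  exact ⟨⟨c, hmem⟩, Subtype.ext hc'⟩

end ZeroSum

/-! ### Divisor homomorphisms into free abelian monoids -/

section DivisorHom

variable {H : Type u} [CommMonoid H] {P : Type v} {φ : H →* FreeAb P}

lemma IsDivisorHom.isUnit_iff (hφ : IsDivisorHom φ) (a : H) : IsUnit a ↔ φ a = 1 := by
  refine ⟨fun h => freeAb_isUnit_iff.1 (h.map φ), fun h => ?_⟩
  exact isUnit_iff_dvd_one.2 (hφ a 1 (by rw [h, map_one]))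

lemma IsDivisorHom.atomicMonoid (hφ : IsDivisorHom φ) : AtomicMonoid H := by
  suffices h : ∀ (n : ℕ) (a : H), (Multiplicative.toAdd (φ a)).card = n → ¬ IsUnit a →
      ∃ s : Multiset H, (∀ x ∈ s, Irreducible x) ∧ s.prod = a from fun a => h _ a rfl
  intro n
  induction n using Nat.strong_induction_on with
  | _ n ih =>
    intro a hn ha
    by_cases hirr : Irreducible a
    · exact ⟨{a}, by simpa using hirr, by simp⟩
    · rw [_root_.irreducible_iff] at hirr
      push Not at hirr
      obtain ⟨b, c, rfl, hb, hc⟩ := hirr ha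
      have hpos : ∀ d : H, ¬ IsUnit d → 0 < (Multiplicative.toAdd (φ d)).card := by
        intro d hd
        rw [hφ.isUnit_iff] at hd
        exact Multiset.card_pos.2 hd
      have hadd : (Multiplicative.toAdd (φ b)).card + (Multiplicative.toAdd (φ c)).card = n := by
        rw [← hn, map_mul, toAdd_mul, Multiset.card_add]
      have hb' := hpos b hb
      have hc' := hpos c hc
      obtain ⟨s, hs, rfl⟩ := ih _ (by omega) b rfl hb
      obtain ⟨t, ht, rfl⟩ := ih _ (by omega) c rfl hc
      exact ⟨s + t, fun x hx => (Multiset.mem_add.1 hx).elim (hs x) (ht x), Multiset.prod_add _ _⟩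

lemma IsDivisorHom.associated_of_eq [IsCancelMul H] (hφ : IsDivisorHom φ) {a b : H}
    (h : φ a = φ b) : Associated a b := by
  obtain ⟨c, hc⟩ := hφ a b (by rw [h])
  obtain ⟨d, hd⟩ := hφ b a (by rw [h])
  have h1 : c * d = 1 := by
    refine mul_left_cancel (a := a) ?_
    rw [← mul_assoc, ← hc, ← hd, mul_one]
  exact ⟨⟨c, d, h1, by rw [mul_comm, h1]⟩, hc.symm⟩

/-! ### Classes -/

lemma cls_mul (x y : FreeAb P) : cls φ (x * y) = cls φ x + cls φ y := by
  unfold cls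
  rw [map_mul]
  rfl

lemma cls_one : cls φ 1 = 0 := by
  unfold cls
  rw [map_one]
  rfl

lemma cls_ofAdd (X : Multiset P) :
    cls φ (Multiplicative.ofAdd X) = (X.map fun p => cls φ (gen p)).sum := by
  induction X using Multiset.induction with
  | empty => exact cls_one
  | cons p X ih =>
    rw [Multiset.map_cons, Multiset.sum_cons, ← ih, ← cls_mul]
    rfl

/-- Elements of the generated subgroup are quotients `φ v / φ u`. If such a quotient is the integral
divisor `x`, then `φ u ∣ φ v`, hence `u ∣ v`, and the cofactor maps to `x`. -/
lemma cls_eq_zero_iff (hφ : IsDivisorHom φ) (x : FreeAb P) : cls φ x = 0 ↔ ∃ a, φ a = x := by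
  have h0 : cls φ x = 0 ↔ Algebra.GrothendieckGroup.of x ∈
      Subgroup.closure (Algebra.GrothendieckGroup.of '' Set.range φ) :=
    QuotientGroup.eq_one_iff _
  rw [h0]
  constructor
  · intro h
    have key : ∀ g ∈ Subgroup.closure (Algebra.GrothendieckGroup.of '' Set.range φ),
        ∃ u v, g * Algebra.GrothendieckGroup.of (φ u) = Algebra.GrothendieckGroup.of (φ v) := by
      intro g h
      induction h using Subgroup.closure_induction with
      | mem g hg =>
        obtain ⟨-, ⟨a, rfl⟩, rfl⟩ := hg
        exact ⟨1, a, by simp⟩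
      | one => exact ⟨1, 1, by simp⟩
      | mul g g' _ _ h h' =>
        obtain ⟨u, v, h⟩ := h
        obtain ⟨u', v', h'⟩ := h'
        refine ⟨u * u', v * v', ?_⟩
        rw [map_mul, map_mul, map_mul, map_mul, ← h, ← h', mul_mul_mul_comm]
      | inv g _ h =>
        obtain ⟨u, v, h⟩ := h
        exact ⟨v, u, by rw [← h, inv_mul_cancel_left]⟩
    obtain ⟨u, v, h⟩ := key _ h
    rw [← map_mul] at h
    have h' := Algebra.GrothendieckGroup.of_injective h
    obtain ⟨w, rfl⟩ := hφ u v ⟨x, by rw [← h', mul_comm]⟩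
    refine ⟨w, mul_left_cancel (a := φ u) ?_⟩
    rw [← map_mul, ← h', mul_comm]
  · rintro ⟨a, rfl⟩
    exact Subgroup.subset_closure ⟨_, ⟨a, rfl⟩, rfl⟩

end DivisorHom

/-! ### Block homomorphisms are transfer homomorphisms -/

/-- The properties of a divisor theory `φ` with classes `β` which make `θ` a transfer
homomorphism. -/
structure IsBlockDatum {H : Type u} [CommMonoid H] {P : Type v} {G : Type w} [AddCommGroup G]
    {G₀ : Set G} (θ : H →* ZeroSum G₀) (φ : H →* FreeAb P) (β : P → G) : Prop where
  divisorHom : IsDivisorHom φ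
  exists_eq : ∀ X : Multiset P, (X.map β).sum = 0 → ∃ a, φ a = Multiplicative.ofAdd X
  range_eq : G₀ = Set.range β
  terms_eq : ∀ a, terms (θ a) = (Multiplicative.toAdd (φ a)).map β

lemma IsBlockHom.exists_datum {H : Type u} [CommMonoid H] {G : Type u} [AddCommGroup G]
    {G₀ : Set G} {θ : H →* ZeroSum G₀} (h : IsBlockHom θ) :
    ∃ (P : Type u) (φ : H →* FreeAb P) (β : P → G), IsBlockDatum θ φ β := by
  obtain ⟨P, φ, e, hφ, hG, hθ⟩ := h
  refine ⟨P, φ, fun p => e (cls φ (gen p)), hφ.divisorHom, fun X hX => ?_, hG, hθ⟩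
  have h1 : e (cls φ (Multiplicative.ofAdd X)) = 0 := by
    rw [cls_ofAdd, map_multiset_sum, Multiset.map_map]
    exact hX
  rw [EmbeddingLike.map_eq_zero_iff] at h1
  exact (cls_eq_zero_iff hφ.divisorHom _).1 h1

namespace IsBlockDatum

variable {H : Type u} [CommMonoid H] [IsCancelMul H] {P : Type v} {G : Type w} [AddCommGroup G]
  {G₀ : Set G} {θ : H →* ZeroSum G₀} {φ : H →* FreeAb P} {β : P → G}

lemma isTransferHom (D : IsBlockDatum θ φ β) : IsTransferHom θ where
  atomic_left := D.divisorHom.atomicMonoid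
  atomic_right := isDivisorHom_subtype.atomicMonoid
  surj S := by
    obtain ⟨X, hX⟩ : ∃ X : Multiset P, X.map β = terms S := by
      have hsurj : ∀ g ∈ terms S, ∃ p, β p = g := fun g hg => by
        have := mem_of_mem_terms hg
        rwa [D.range_eq] at this
      choose r hr using hsurj
      refine ⟨(terms S).attach.map fun g => r g.1 g.2, ?_⟩
      rw [Multiset.map_map]
      conv_rhs => rw [← Multiset.attach_map_val (terms S)]
      exact Multiset.map_congr rfl fun g _ => hr g.1 g.2
    obtain ⟨a, ha⟩ := D.exists_eq X (by rw [hX, sum_terms])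
    refine ⟨1, 1, a, terms_injective ?_⟩
    rw [Units.val_one, one_mul, mul_one, D.terms_eq, ha, toAdd_ofAdd, hX]
  isUnit_iff a := by
    rw [zeroSum_isUnit_iff, D.divisorHom.isUnit_iff, ← terms_injective.eq_iff, D.terms_eq,
      terms_one, Multiset.map_eq_zero]
    exact Iff.rfl
  lift a b c h := by
    have h1 := D.terms_eq a
    rw [h, terms_mul] at h1
    obtain ⟨X, Y, hXY, hX, hY⟩ := exists_add_of_map_eq_add β _ _ _ h1.symm
    obtain ⟨x, hx⟩ := D.exists_eq X (by rw [hX, sum_terms])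
    obtain ⟨y, hy⟩ := D.exists_eq Y (by rw [hY, sum_terms])
    -- Equal divisors determine elements only up to a unit; `e` is moved into the second factor,
    -- where `φ` does not see it.
    obtain ⟨e, he⟩ := D.divisorHom.associated_of_eq (a := x * y) (b := a) (by
      rw [map_mul, hx, hy]
      exact hXY.symm)
    have hφe : φ (y * e) = φ y := by
      rw [map_mul, (D.divisorHom.isUnit_iff _).1 e.isUnit, mul_one]
    refine ⟨x, y * e, 1, by rw [← he, mul_assoc], terms_injective ?_, terms_injective ?_⟩
    · rw [D.terms_eq, hx, toAdd_ofAdd, hX, inv_one, Units.val_one, mul_one]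
    · rw [D.terms_eq, hφe, hy, toAdd_ofAdd, hY, Units.val_one, one_mul]

end IsBlockDatum

/-! ### Exchanging primes inside the fibres of a block homomorphism -/

/-- Equal cardinality forces some `p` to be deficient in `X`. Since the class of `p` has the same
total multiplicity in both multisets, the deficit is compensated by a surplus `q` in that class. -/
lemma exists_count_lt_of_map_eq {P : Type v} {G : Type w} {β : P → G}
    {X Y : Multiset P} [DecidableEq P]
    (h : X.map β = Y.map β) (hne : X ≠ Y) :
    ∃ p q, β p = β q ∧ X.count p < Y.count p ∧ Y.count q < X.count q := by
  classical
  obtain ⟨p, hp⟩ : ∃ p, X.count p < Y.count p := by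
    by_contra! hcon
    have hle : Y ≤ X := Multiset.le_iff_count.2 hcon
    have hcard := congrArg Multiset.card h
    rw [Multiset.card_map, Multiset.card_map] at hcard
    exact hne (Multiset.eq_of_le_of_card_le hle hcard.le).symm
  refine ⟨p, ?_⟩
  by_contra! hcon
  have hle : X.filter (fun q => β p = β q) ≤ Y.filter (fun q => β p = β q) := by
    rw [Multiset.le_iff_count]
    intro q
    by_cases hq : β p = β q
    · rw [Multiset.count_filter_of_pos (p := fun q => β p = β q) hq,
        Multiset.count_filter_of_pos (p := fun q => β p = β q) hq]
      exact hcon q hq hp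
    · rw [Multiset.count_filter_of_neg (p := fun q => β p = β q) hq]
      exact Nat.zero_le _
  have hcard := congrArg (Multiset.count (β p)) h
  rw [Multiset.count_map, Multiset.count_map] at hcard
  have heq := Multiset.eq_of_le_of_card_le hle hcard.ge
  have hc := congrArg (Multiset.count p) heq
  rw [Multiset.count_filter_of_pos (p := fun q => β p = β q) rfl,
    Multiset.count_filter_of_pos (p := fun q => β p = β q) rfl] at hc
  omega

/-- The homomorphism induced by a homomorphism into a free abelian monoid on the associated
reduced monoid. -/
def redDivisor {H : Type u} [CommMonoid H] {P : Type v} (φ : H →* FreeAb P) :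
    Associates H →* FreeAb P where
  toFun := Quotient.lift φ (by
    rintro a _ ⟨e, rfl⟩
    rw [map_mul, freeAb_isUnit_iff.1 (e.isUnit.map φ), mul_one])
  map_one' := map_one φ
  map_mul' := by
    rintro ⟨a⟩ ⟨b⟩
    exact map_mul φ a b

@[simp] lemma redDivisor_mk {H : Type u} [CommMonoid H] {P : Type v} (φ : H →* FreeAb P)
    (a : H) : redDivisor φ (Associates.mk a) = φ a := rfl

namespace IsBlockDatum

variable {H : Type u} [CommMonoid H] {P : Type v} {G : Type w} [AddCommGroup G]
  {G₀ : Set G} {θ : H →* ZeroSum G₀} {φ : H →* FreeAb P} {β : P → G}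

lemma redDivisor_injective [IsCancelMul H] (D : IsBlockDatum θ φ β) :
    Function.Injective (redDivisor φ) := by
  intro a b h
  obtain ⟨a, rfl⟩ := Associates.exists_rep a
  obtain ⟨b, rfl⟩ := Associates.exists_rep b
  exact Associates.mk_eq_mk_iff_associated.2 (D.divisorHom.associated_of_eq h)

lemma redMap_eq_iff (D : IsBlockDatum θ φ β) (a b : Associates H) :
    redMap θ a = redMap θ b ↔ (Multiplicative.toAdd (redDivisor φ a)).map β =
      (Multiplicative.toAdd (redDivisor φ b)).map β := by
  obtain ⟨a, rfl⟩ := Associates.exists_rep a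
  obtain ⟨b, rfl⟩ := Associates.exists_rep b
  rw [redMap_mk, redMap_mk, Associates.mk_injective.eq_iff, ← terms_injective.eq_iff,
    D.terms_eq, D.terms_eq, redDivisor_mk, redDivisor_mk]

lemma sum_redDivisor (D : IsBlockDatum θ φ β) (a : Associates H) :
    ((Multiplicative.toAdd (redDivisor φ a)).map β).sum = 0 := by
  obtain ⟨a, rfl⟩ := Associates.exists_rep a
  rw [redDivisor_mk, ← D.terms_eq, sum_terms]

lemma exists_redDivisor_eq (D : IsBlockDatum θ φ β) (X : Multiset P) (hX : (X.map β).sum = 0) :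
    ∃ a : Associates H, redDivisor φ a = Multiplicative.ofAdd X := by
  obtain ⟨a, ha⟩ := D.exists_eq X hX
  exact ⟨Associates.mk a, ha⟩

/-- The multiset of prime divisors of an element of the reduced monoid. -/
abbrev primes (φ : H →* FreeAb P) (a : Associates H) : Multiset P :=
  Multiplicative.toAdd (redDivisor φ a)

variable [IsCancelMul H]

/-- Take `p` deficient and `q` in surplus in `u` relative to `v`, of the same class. As `v` divides
`x`, the missing `p` occurs in another atom `w`. Swapping `q` in `u` with `p` in `w` preserves both
blocks, hence irreducibility, and the product; it brings `u` one prime closer to `v`. -/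
lemma exists_exchange [DecidableEq P] (D : IsBlockDatum θ φ β)
    (hf : IsReducedTransfer (redMap θ))
    {x : Associates H} {u v : RedAtom H} {z : Multiset (RedAtom H)}
    (hz : u ::ₘ z ∈ redFactorizations x) (hv : v.1 ∣ x) (huv : hf.atomMap u = hf.atomMap v)
    (hne : u ≠ v) :
    ∃ (u' : RedAtom H) (z' : Multiset (RedAtom H)), u' ::ₘ z' ∈ redFactorizations x ∧
      hf.atomMap u' = hf.atomMap u ∧ z'.map hf.atomMap = z.map hf.atomMap ∧
      fdist (u ::ₘ z) (u' ::ₘ z') ≤ 2 ∧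
      (primes φ v - primes φ u').card < (primes φ v - primes φ u).card := by
  have hmap : (primes φ u).map β = (primes φ v).map β :=
    (D.redMap_eq_iff u v).1 (congrArg Subtype.val huv)
  obtain ⟨p, q, hpq, hp, hq⟩ := exists_count_lt_of_map_eq hmap fun h =>
    hne (Subtype.ext (D.redDivisor_injective h))
  have hx : primes φ x = primes φ u + primes φ (z.map Subtype.val).prod := by
    rw [← mem_redFactorizations.1 hz, Multiset.map_cons, Multiset.prod_cons, primes, map_mul]
    rfl
  obtain ⟨w, hw, hpw⟩ : ∃ w ∈ z, p ∈ primes φ w := by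
    have h1 : (primes φ v).count p ≤ (primes φ x).count p := by
      obtain ⟨c, rfl⟩ := hv
      have h2 : primes φ (v.1 * c) = primes φ v + primes φ c := by
        rw [primes, map_mul]
        rfl
      rw [h2, Multiset.count_add]
      exact Nat.le_add_right _ _
    rw [hx, Multiset.count_add] at h1
    have h2 : p ∈ primes φ (z.map Subtype.val).prod := Multiset.count_pos.1 (by omega)
    clear h1 hx hz
    induction z using Multiset.induction with
    | empty => simp [primes] at h2
    | cons w z ih =>
      rw [Multiset.map_cons, Multiset.prod_cons, primes, map_mul, toAdd_mul,
        Multiset.mem_add] at h2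
      rcases h2 with h2 | h2
      · exact ⟨w, by simp, h2⟩
      · obtain ⟨w', hw', h3⟩ := ih h2
        exact ⟨w', by simp [hw'], h3⟩
  obtain ⟨z, rfl⟩ := Multiset.exists_cons_of_mem hw
  have hqu : q ∈ primes φ u := Multiset.count_pos.1 (by omega)
  -- Substituting a prime of the same class leaves the block unchanged, and atoms are recognized by
  -- their blocks.
  have hrep : ∀ (y : RedAtom H) (r s : P), r ∈ primes φ y → β s = β r →
      ∃ y' : RedAtom H, primes φ y' = s ::ₘ (primes φ y).erase r ∧
        hf.atomMap y' = hf.atomMap y := by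
    intro y r s hr hrs
    have hm : (s ::ₘ (primes φ y).erase r).map β = (primes φ y).map β := by
      conv_rhs => rw [← Multiset.cons_erase hr]
      rw [Multiset.map_cons, Multiset.map_cons, hrs]
    obtain ⟨y', hy'⟩ := D.exists_redDivisor_eq (s ::ₘ (primes φ y).erase r)
      (by rw [hm, D.sum_redDivisor])
    have hmap' : redMap θ y' = redMap θ y := by
      rw [D.redMap_eq_iff, hy']
      exact hm
    refine ⟨⟨y', ?_⟩, congrArg Multiplicative.toAdd hy', Subtype.ext hmap'⟩
    rw [← hf.irreducible_iff, hmap', hf.irreducible_iff]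
    exact y.2
  obtain ⟨u', hu', huu'⟩ := hrep u q p hqu hpq
  obtain ⟨w', hw', hww'⟩ := hrep w p q hpw hpq.symm
  have hmul : u'.1 * w'.1 = u.1 * w.1 := by
    apply D.redDivisor_injective
    rw [map_mul, map_mul]
    change primes φ u' + primes φ w' = primes φ u + primes φ w
    rw [hu', hw', ← Multiset.cons_erase hqu, ← Multiset.cons_erase hpw]
    simp only [Multiset.erase_cons_head, Multiset.cons_add, Multiset.add_cons]
    rw [Multiset.cons_swap]
  refine ⟨u', w' ::ₘ z, ?_, huu', by simp [hww'], ?_, ?_⟩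
  · rw [mem_redFactorizations] at hz ⊢
    rw [← hz]
    simp only [Multiset.map_cons, Multiset.prod_cons]
    rw [← mul_assoc, hmul, mul_assoc]
  · have hsplit : ∀ a b : RedAtom H, a ::ₘ b ::ₘ z = z + {a, b} := fun a b => by
      rw [add_comm, Multiset.insert_eq_cons, Multiset.cons_add, Multiset.singleton_add]
    rw [hsplit, hsplit, fdist_add_left]
    exact (fdist_le_card _ _).trans (by simp)
  · have hne' : p ≠ q := by
      rintro rfl
      omega
    have hlt : primes φ v - primes φ u' = (primes φ v - primes φ u).erase p := by
      ext r
      rw [hu', Multiset.count_sub, Multiset.count_cons]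
      by_cases hrp : r = p
      · subst hrp
        rw [Multiset.count_erase_self, Multiset.count_sub, Multiset.count_erase_of_ne hne']
        simp only [if_true]
        omega
      · rw [Multiset.count_erase_of_ne hrp, Multiset.count_sub, if_neg hrp]
        by_cases hrq : r = q
        · subst hrq
          rw [Multiset.count_erase_self]
          omega
        · rw [Multiset.count_erase_of_ne hrq]
          rfl
    rw [hlt]
    refine Multiset.card_erase_lt_of_mem (Multiset.count_pos.1 ?_)
    rw [Multiset.count_sub]
    omega

/-- Iterated exchange. The 2-chain serves the catenary degree, the bound `2 * n` serves tameness. -/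
lemma exists_replace [DecidableEq P] (D : IsBlockDatum θ φ β)
    (hf : IsReducedTransfer (redMap θ))
    {x : Associates H} {v : RedAtom H} (hv : v.1 ∣ x) (n : ℕ) :
    ∀ {u : RedAtom H} {z : Multiset (RedAtom H)}, u ::ₘ z ∈ redFactorizations x →
      hf.atomMap u = hf.atomMap v → (primes φ v - primes φ u).card = n →
      ∃ z' : Multiset (RedAtom H), v ::ₘ z' ∈ redFactorizations x ∧
        z'.map hf.atomMap = z.map hf.atomMap ∧ RedChained x 2 (u ::ₘ z) (v ::ₘ z') ∧
        fdist (u ::ₘ z) (v ::ₘ z') ≤ 2 * n := by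
  induction n using Nat.strong_induction_on with
  | _ n ih =>
    intro u z hz huv hn
    by_cases hne : u = v
    · subst hne
      exact ⟨z, hz, rfl, Relation.ReflTransGen.refl, by rw [fdist_self]; exact Nat.zero_le _⟩
    · obtain ⟨u', z', hz', hu', hm, hd, hlt⟩ := D.exists_exchange hf hz hv huv hne
      rw [hn] at hlt
      obtain ⟨z'', h1, h2, h3, h4⟩ := ih _ hlt hz' (hu'.trans huv) rfl
      refine ⟨z'', h1, h2.trans hm, Relation.ReflTransGen.head ⟨hz, hz', ?_⟩ h3, ?_⟩
      · exact_mod_cast hd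
      · have := fdist_triangle (u ::ₘ z) (u' ::ₘ z') (v ::ₘ z'')
        omega

/-- Exchanges produce the first atom of `z'`; it is then cancelled and the remaining factorizations
are treated inductively. -/
lemma redChained_fibre (D : IsBlockDatum θ φ β) (hf : IsReducedTransfer (redMap θ))
    (z' : Multiset (RedAtom H)) : ∀ (x : Associates H) (z : Multiset (RedAtom H)),
      z ∈ redFactorizations x → z' ∈ redFactorizations x →
      z.map hf.atomMap = z'.map hf.atomMap → RedChained x 2 z z' := by
  classical
  induction z' using Multiset.induction with
  | empty =>
    intro x z _ _ h
    rw [Multiset.map_zero, Multiset.map_eq_zero] at h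
    rw [h]
    exact Relation.ReflTransGen.refl
  | cons v w ih =>
    intro x z hz hz' h
    have hvx : v.1 ∣ x := by
      rw [← mem_redFactorizations.1 hz', Multiset.map_cons, Multiset.prod_cons]
      exact dvd_mul_right _ _
    rw [Multiset.map_cons, ← Multiset.map_eq_cons] at h
    obtain ⟨u, hu, huv, h⟩ := h
    obtain ⟨z, rfl⟩ := Multiset.exists_cons_of_mem hu
    rw [Multiset.erase_cons_head] at h
    obtain ⟨z₁, hz₁, hm, hc, -⟩ := D.exists_replace hf hvx _ hz huv rfl
    refine Relation.ReflTransGen.trans hc ?_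
    have hprod : (z₁.map Subtype.val).prod = (w.map Subtype.val).prod := by
      have h1 := hz₁.trans hz'.symm
      simp only [Multiset.map_cons, Multiset.prod_cons] at h1
      exact mul_left_cancel h1
    have h2 := (ih (w.map Subtype.val).prod z₁ hprod rfl (hm.trans h)).add_left (y := v.1)
      (s := {v}) (by simp [mem_redFactorizations])
    rw [← mem_redFactorizations.1 hz', Multiset.map_cons, Multiset.prod_cons]
    exact h2

lemma catenaryDegree_le (D : IsBlockDatum θ φ β) :
    catenaryDegree H ≤ max (catenaryDegree (ZeroSum G₀)) 2 := by
  have hf := D.isTransferHom.isReducedTransfer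
  refine iSup_le fun a => le_trans ?_
    (max_le_max (le_iSup (fun b : ZeroSum G₀ => catenaryDeg b) (θ a)) le_rfl)
  refine sInf_le fun z hz z' hz' => ?_
  have h1 : RedChained (redMap θ (Associates.mk a)) (catenaryDeg (θ a)) (z.map hf.atomMap)
      (z'.map hf.atomMap) :=
    chained_catenaryDeg (map_atomMap_mem hf hz) (map_atomMap_mem hf hz')
  obtain ⟨z₁, hz₁, hm, hc⟩ := h1.exists_lift hf hz rfl
  exact Relation.ReflTransGen.trans (hc.mono (le_max_left _ _))
    ((D.redChained_fibre hf _ _ _ hz₁ hz' hm).mono (le_max_right _ _))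

lemma locallyTame (D : IsBlockDatum θ φ β) (h : LocallyTame (ZeroSum G₀)) : LocallyTame H := by
  classical
  have hf := D.isTransferHom.isReducedTransfer
  rw [locallyTame_iff] at h ⊢
  intro v
  obtain ⟨M, hM⟩ := h (hf.atomMap v)
  -- `M` pays for reaching an atom with the block of `v`; at most one exchange per prime of `v` then
  -- turns it into `v` itself.
  refine ⟨M + 2 * (primes φ v).card, fun a hva ⟨y, hy, hvy⟩ z hz => ?_⟩
  obtain ⟨y', hy', hvy', hd⟩ := hM (redMap θ a) (map_dvd (redMap θ) hva)
    ⟨_, map_atomMap_mem hf hy, Multiset.mem_map_of_mem _ hvy⟩ _ (map_atomMap_mem hf hz)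
  obtain ⟨z₁, hz₁, rfl, hd₁⟩ := exists_lift_factorization_fdist_le hf hz hy'
  obtain ⟨u, hu, huv⟩ := Multiset.mem_map.1 hvy'
  obtain ⟨z₁, rfl⟩ := Multiset.exists_cons_of_mem hu
  obtain ⟨z₂, hz₂, -, -, hd₂⟩ := D.exists_replace hf hva _ hz₁ huv rfl
  refine ⟨v ::ₘ z₂, hz₂, by simp, ?_⟩
  have h3 := fdist_triangle z (u ::ₘ z₁) (v ::ₘ z₂)
  have h4 : (primes φ v - primes φ u).card ≤ (primes φ v).card :=
    Multiset.card_le_card tsub_le_self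
  omega

end IsBlockDatum

/-! ### Transport of arithmetic along block homomorphisms -/

/-- The arithmetic of `H` is controlled by that of `B` through `θ`. -/
structure ControlsArithmetic {H : Type u} {B : Type v} [CommMonoid H] [CommMonoid B]
    (θ : H →* B) : Prop where
  transfer : IsTransferHom θ
  lengthSystem_eq : lengthSystem H = lengthSystem B
  catenaryDegree_le : catenaryDegree B ≤ catenaryDegree H
  le_catenaryDegree : catenaryDegree H ≤ max (catenaryDegree B) 2
  locallyTame_iff : LocallyTame H ↔ LocallyTame B

lemma IsBlockHom.controlsArithmetic {H : Type u} [CommMonoid H] [IsCancelMul H] {G : Type u}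
    [AddCommGroup G] {G₀ : Set G} {θ : H →* ZeroSum G₀} (h : IsBlockHom θ) :
    ControlsArithmetic θ := by
  obtain ⟨P, φ, β, D⟩ := h.exists_datum
  exact ⟨D.isTransferHom, D.isTransferHom.lengthSystem_eq, D.isTransferHom.catenaryDegree_le,
    D.catenaryDegree_le, D.isTransferHom.locallyTame, D.locallyTame⟩

lemma ControlsArithmetic.comp {H : Type u} {B : Type v} {C : Type w} [CommMonoid H] [CommMonoid B]
    [CommMonoid C] [Subsingleton Bˣ] [Subsingleton Cˣ] {θ : H →* B} {η : B →* C}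
    (hη : ControlsArithmetic η) (hθ : ControlsArithmetic θ) :
    ControlsArithmetic (η.comp θ) where
  transfer := hη.transfer.comp hθ.transfer
  lengthSystem_eq := hθ.lengthSystem_eq.trans hη.lengthSystem_eq
  catenaryDegree_le := hη.catenaryDegree_le.trans hθ.catenaryDegree_le
  le_catenaryDegree := hθ.le_catenaryDegree.trans
    (max_le hη.le_catenaryDegree (le_max_right _ _))
  locallyTame_iff := hθ.locallyTame_iff.trans hη.locallyTame_iff

/-! ### Valuations of a homomorphism into a free abelian monoid -/

section Valuation

variable {H : Type u} [CommMonoid H] {P : Type v} {φ : H →* FreeAb P}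

open Classical in
/-- The exponent of `p` in `φ a`. -/
def valuation (φ : H →* FreeAb P) (p : P) (a : H) : ℕ := (Multiplicative.toAdd (φ a)).count p

@[simp] lemma valuation_one (p : P) : valuation φ p 1 = 0 := by
  simp [valuation]

@[simp] lemma valuation_mul (p : P) (a b : H) :
    valuation φ p (a * b) = valuation φ p a + valuation φ p b := by
  simp [valuation]

@[simp] lemma valuation_pow (p : P) (a : H) (n : ℕ) :
    valuation φ p (a ^ n) = n * valuation φ p a := by
  simp [valuation]

lemma valuation_pos_iff {p : P} {a : H} :
    0 < valuation φ p a ↔ p ∈ Multiplicative.toAdd (φ a) := by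
  classical
  exact Multiset.count_pos

lemma gen_dvd_iff_valuation_pos {p : P} {a : H} : gen p ∣ φ a ↔ 0 < valuation φ p a := by
  rw [freeAb_dvd_iff, valuation_pos_iff]
  exact Multiset.singleton_le

lemma map_dvd_map_iff_valuation {a b : H} :
    φ a ∣ φ b ↔ ∀ p, valuation φ p a ≤ valuation φ p b := by
  classical
  rw [freeAb_dvd_iff, Multiset.le_iff_count]
  exact Iff.rfl

lemma IsDivisorHom.exists_mul_eq (hφ : IsDivisorHom φ) {a b : H}
    (h : ∀ p, valuation φ p a ≤ valuation φ p b) : ∃ c, b = a * c :=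
  hφ a b (map_dvd_map_iff_valuation.2 h)

lemma exists_valuation_eq_zero_and_count_le [DecidableEq P] {p : P}
    (h : ∀ q, q ≠ p → ∃ x : H, 0 < valuation φ q x ∧ valuation φ p x = 0) (X : Multiset P) :
    ∃ z : H, valuation φ p z = 0 ∧ ∀ q, q ≠ p → X.count q ≤ valuation φ q z := by
  induction X using Multiset.induction with
  | empty => exact ⟨1, by simp, by simp⟩
  | cons r X ih =>
    obtain ⟨z, hz, hX⟩ := ih
    by_cases hr : r = p
    · refine ⟨z, hz, fun q hq => ?_⟩
      rw [Multiset.count_cons_of_ne (by rw [hr]; exact hq)]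
      exact hX q hq
    · obtain ⟨x, hx, hx0⟩ := h r hr
      refine ⟨z * x, by simp [hz, hx0], fun q hq => ?_⟩
      have := hX q hq
      rw [valuation_mul, Multiset.count_cons]
      split_ifs with hqr
      · subst hqr
        omega
      · omega

/-- A divisor homomorphism is a divisor theory if its valuations are pairwise independent and
normalized. -/
lemma IsDivisorHom.isDivisorTheory (hφ : IsDivisorHom φ)
    (hsep : ∀ p q, q ≠ p → ∃ x : H, 0 < valuation φ q x ∧ valuation φ p x = 0)
    (hnorm : ∀ p, ∃ x y : H, valuation φ p x = valuation φ p y + 1) : IsDivisorTheory φ := by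
  classical
  refine ⟨hφ, fun p => ?_⟩
  obtain ⟨x, y, hxy⟩ := hnorm p
  -- Multiplying `x` by `z` makes it divisible by `y` without changing its value at `p`, so the
  -- quotient `w` has value exactly 1 there.
  obtain ⟨z, hz, hyz⟩ := exists_valuation_eq_zero_and_count_le (hsep p) (Multiplicative.toAdd (φ y))
  obtain ⟨w, hw⟩ := hφ.exists_mul_eq (a := y) (b := x * z) fun q => by
    rw [valuation_mul]
    by_cases hq : q = p
    · subst hq
      omega
    · exact (hyz q hq).trans (Nat.le_add_left _ _)
  have hwp : valuation φ p w = 1 := by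
    have := congrArg (valuation φ p) hw
    rw [valuation_mul, valuation_mul] at this
    omega
  have hsep' : ∀ q, q ≠ p → ∃ x : H, 0 < valuation φ p x ∧ valuation φ q x = 0 :=
    fun q hq => hsep q p hq.symm
  -- For each other prime `q` of `w`, the element `t q` is divisible by `p` but not by `q`. The
  -- greatest common divisor of `w` and these elements is therefore `p`.
  choose! t htp htq using hsep'
  refine ⟨insert w (((Multiplicative.toAdd (φ w)).toFinset.filter (· ≠ p)).image t),
    Finset.insert_nonempty _ _, ?_, ?_⟩
  · intro a ha
    rw [gen_dvd_iff_valuation_pos]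
    rcases Finset.mem_insert.1 ha with rfl | ha
    · omega
    · obtain ⟨q, hq, rfl⟩ := Finset.mem_image.1 ha
      exact htp q (Finset.mem_filter.1 hq).2
  · intro d hd
    have hd' : ∀ a ∈ insert w (((Multiplicative.toAdd (φ w)).toFinset.filter (· ≠ p)).image t),
        ∀ q, (Multiplicative.toAdd d).count q ≤ valuation φ q a := fun a ha q =>
      Multiset.le_iff_count.1 (freeAb_dvd_iff.1 (hd a ha)) q
    rw [freeAb_dvd_iff, Multiset.le_iff_count]
    intro q
    change _ ≤ Multiset.count q {p}
    have hdw := hd' w (Finset.mem_insert_self _ _) q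
    rw [Multiset.count_singleton]
    split_ifs with hq
    · rw [← hwp, ← hq]
      exact hdw
    · by_cases hqw : 0 < valuation φ q w
      · rw [← htq q hq]
        refine hd' _ (Finset.mem_insert_of_mem (Finset.mem_image_of_mem _ ?_)) q
        rw [Finset.mem_filter, Multiset.mem_toFinset]
        exact ⟨valuation_pos_iff.1 hqw, hq⟩
      · omega

/-- If no integer `n > 1` divides a valuation, then the valuation is normalized. -/
lemma exists_valuation_eq_add_one {p : P} (hpos : ∃ x : H, 0 < valuation φ p x)
    (h : ∀ n, 1 < n → ∃ x : H, ¬ n ∣ valuation φ p x) :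
    ∃ x y : H, valuation φ p x = valuation φ p y + 1 := by
  -- The differences of values form a subgroup of `ℤ` whose generator divides every value; the
  -- hypotheses leave only `±1`.
  let K : AddSubgroup ℤ :=
    { carrier := {k | ∃ x y : H, k = valuation φ p x - valuation φ p y}
      zero_mem' := ⟨1, 1, by simp⟩
      add_mem' := by
        rintro _ _ ⟨x, y, rfl⟩ ⟨x', y', rfl⟩
        exact ⟨x * x', y * y', by simp only [valuation_mul, Nat.cast_add]; ring⟩
      neg_mem' := by
        rintro _ ⟨x, y, rfl⟩
        exact ⟨y, x, by ring⟩ }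
  obtain ⟨m, hm⟩ := Int.subgroup_cyclic K
  have hdvd : ∀ x : H, m.natAbs ∣ valuation φ p x := by
    intro x
    have hx : (valuation φ p x : ℤ) ∈ K := ⟨x, 1, by simp⟩
    rw [hm, AddSubgroup.mem_closure_singleton] at hx
    obtain ⟨k, hk⟩ := hx
    rw [← Int.natCast_dvd_natCast, Int.natAbs_dvd]
    exact ⟨k, by rw [← hk, smul_eq_mul, mul_comm]⟩
  have hle : m.natAbs ≤ 1 := by
    by_contra hlt
    obtain ⟨x, hx⟩ := h m.natAbs (by omega)
    exact hx (hdvd x)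
  have hne : m.natAbs ≠ 0 := by
    intro h0
    obtain ⟨x, hx⟩ := hpos
    have := hdvd x
    rw [h0, zero_dvd_iff] at this
    omega
  have h1 : (1 : ℤ) ∈ K := by
    have hmK : m ∈ K := hm ▸ AddSubgroup.subset_closure rfl
    rcases Int.natAbs_eq m with h2 | h2
    · rwa [show m = 1 by omega] at hmK
    · have := K.neg_mem hmK
      rwa [show -m = 1 by omega] at this
  obtain ⟨x, y, hxy⟩ := h1
  exact ⟨x, y, by omega⟩

/-! ### Ample elements and the construction of divisor theories -/

/-- An element `a` is ample for `φ : H → 𝓕(P)` if every class of `φ` contains a divisor composed of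
prime divisors of `a`. -/
def IsAmple (φ : H →* FreeAb P) (a : H) : Prop :=
  ∀ X : Multiset P, ∃ Y : Multiset P, (∀ p ∈ Y, p ∈ Multiplicative.toAdd (φ a)) ∧
    ∃ h, φ h = Multiplicative.ofAdd (X + Y)

lemma IsAmple.exists_dvd {a : H} (ha : IsAmple φ a) (p : P) : ∃ h, gen p ∣ φ h := by
  obtain ⟨Y, -, h, hh⟩ := ha {p}
  exact ⟨h, Multiplicative.ofAdd Y, hh⟩

lemma IsAmple.exists_valuation_pos {a : H} (ha : IsAmple φ a) (p : P) :
    ∃ h, 0 < valuation φ p h := by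
  obtain ⟨h, hh⟩ := ha.exists_dvd p
  exact ⟨h, gen_dvd_iff_valuation_pos.1 hh⟩

/-! ### Removing a redundant prime -/

open Classical in
/-- The part of a multiset which does not involve `p`. -/
def awayFrom (p : P) (X : Multiset P) : Multiset {q : P // q ≠ p} :=
  X.filterMap fun q => if h : q ≠ p then some ⟨q, h⟩ else none

lemma awayFrom_add (p : P) (X Y : Multiset P) :
    awayFrom p (X + Y) = awayFrom p X + awayFrom p Y := Multiset.filterMap_add _ _ _

lemma mem_awayFrom {p : P} {X : Multiset P} {q : {q : P // q ≠ p}} :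
    q ∈ awayFrom p X ↔ q.1 ∈ X := by
  unfold awayFrom
  rw [Multiset.mem_filterMap]
  constructor
  · rintro ⟨r, hr, h⟩
    split_ifs at h with hrp
    rw [Option.some.injEq] at h
    rwa [← h]
  · exact fun h => ⟨q.1, h, dif_pos q.2⟩

lemma map_val_awayFrom [DecidableEq P] (p : P) (X : Multiset P) :
    (awayFrom p X).map Subtype.val = X.filter (· ≠ p) := by
  induction X using Multiset.induction with
  | empty => rfl
  | cons r X ih =>
    unfold awayFrom at ih ⊢
    by_cases hr : r ≠ p
    · rw [Multiset.filterMap_cons_some _ _ _ (dif_pos hr), Multiset.map_cons, ih,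
        Multiset.filter_cons_of_pos (p := (· ≠ p)) _ hr]
    · rw [Multiset.filterMap_cons_none _ _ (dif_neg hr), ih,
        Multiset.filter_cons_of_neg (p := (· ≠ p)) _ hr]

lemma awayFrom_map_val {p : P} (X : Multiset {q : P // q ≠ p}) :
    awayFrom p (X.map Subtype.val) = X := by
  classical
  apply Multiset.map_injective Subtype.val_injective
  rw [map_val_awayFrom, Multiset.filter_eq_self]
  intro q hq
  obtain ⟨q, -, rfl⟩ := Multiset.mem_map.1 hq
  exact q.2

/-- Removal of a prime from the target of a homomorphism into a free abelian monoid. -/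
def dropPrime (φ : H →* FreeAb P) (p : P) : H →* FreeAb {q : P // q ≠ p} where
  toFun a := Multiplicative.ofAdd (awayFrom p (Multiplicative.toAdd (φ a)))
  map_one' := by
    rw [map_one]
    rfl
  map_mul' a b := by
    rw [map_mul, toAdd_mul, awayFrom_add, ofAdd_add]

lemma valuation_dropPrime {p : P} (q : {q : P // q ≠ p}) (a : H) :
    valuation (dropPrime φ p) q a = valuation φ q.1 a := by
  classical
  have h := congrArg (Multiset.count q.1) (map_val_awayFrom p (Multiplicative.toAdd (φ a)))
  rw [Multiset.count_map_eq_count' _ _ Subtype.val_injective,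
    Multiset.count_filter_of_pos (p := (· ≠ p)) q.2] at h
  unfold valuation
  refine Eq.trans ?_ (h.trans ?_)
  · rw [show Multiplicative.toAdd (dropPrime φ p a) =
      awayFrom p (Multiplicative.toAdd (φ a)) from rfl]
    congr!
  · congr!

/-- If divisibility held away from `p` but failed at `p`, powers of `y` and `w` could be balanced
against a power of `x` so that the quotient has value 0 at `p` and positive value at `q`, although
`q` forces `p`. -/
lemma IsDivisorHom.dropPrime (hφ : IsDivisorHom φ) {p q : P} (hqp : q ≠ p)
    (hpos : ∃ w : H, 0 < valuation φ q w)
    (hle : ∀ x : H, 0 < valuation φ q x → 0 < valuation φ p x) :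
    IsDivisorHom (dropPrime φ p) := by
  intro x y hxy
  rw [map_dvd_map_iff_valuation] at hxy
  have hxy' : ∀ r, r ≠ p → valuation φ r x ≤ valuation φ r y := fun r hr => by
    simpa only [valuation_dropPrime] using hxy ⟨r, hr⟩
  suffices h : valuation φ p x ≤ valuation φ p y by
    refine hφ x y (map_dvd_map_iff_valuation.2 fun r => ?_)
    by_cases hr : r = p
    · rwa [hr]
    · exact hxy' r hr
  by_contra! hlt
  obtain ⟨w, hw⟩ := hpos
  obtain ⟨m, hm⟩ := Nat.exists_eq_add_of_lt hlt
  -- The exponents are chosen to give equality at `p`: the deficit there is `m + 1`.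
  have hval : ∀ r, valuation φ r (x ^ valuation φ p w) ≤
      valuation φ r (y ^ valuation φ p w * w ^ (m + 1)) := by
    intro r
    rw [valuation_mul, valuation_pow, valuation_pow, valuation_pow]
    by_cases hr : r = p
    · rw [hr, hm]
      exact le_of_eq (by ring)
    · exact (Nat.mul_le_mul_left _ (hxy' r hr)).trans (Nat.le_add_right _ _)
  obtain ⟨z, hz⟩ := hφ.exists_mul_eq hval
  have hzp := congrArg (valuation φ p) hz
  have hzq := congrArg (valuation φ q) hz
  simp only [valuation_mul, valuation_pow] at hzp hzq
  have hzp0 : valuation φ p z = 0 := by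
    rw [hm] at hzp
    linarith
  have hzq0 : 0 < valuation φ q z := by
    have h1 := Nat.mul_le_mul_left (valuation φ p w) (hxy' q hqp)
    have h2 : 0 < (m + 1) * valuation φ q w := Nat.mul_pos (Nat.succ_pos _) hw
    omega
  have := hle z hzq0
  omega

lemma IsAmple.dropPrime {a : H} (ha : IsAmple φ a) (p : P) : IsAmple (dropPrime φ p) a := by
  intro X
  obtain ⟨Y, hY, h, hh⟩ := ha (X.map Subtype.val)
  refine ⟨awayFrom p Y, fun q hq => ?_, h, ?_⟩
  · exact mem_awayFrom.2 (hY _ (mem_awayFrom.1 hq))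
  · change Multiplicative.ofAdd (awayFrom p (Multiplicative.toAdd (φ h))) = _
    rw [hh, toAdd_ofAdd, awayFrom_add, awayFrom_map_val]

lemma card_dropPrime_lt {a : H} {p : P} (hp : p ∈ Multiplicative.toAdd (φ a)) :
    (Multiplicative.toAdd (dropPrime φ p a)).card < (Multiplicative.toAdd (φ a)).card := by
  classical
  change (awayFrom p (Multiplicative.toAdd (φ a))).card < _
  rw [← Multiset.card_map Subtype.val, map_val_awayFrom]
  refine Multiset.card_lt_card (lt_of_le_of_ne (Multiset.filter_le _ _) fun h => ?_)
  exact Multiset.filter_eq_self.1 h p hp rfl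

/-! ### Dividing a valuation by a common factor -/

open Classical in
/-- Division by `n` of the multiplicity of `p` in a multiset. -/
def divCount (p : P) (n : ℕ) (X : Multiset P) : Multiset P :=
  X.filter (· ≠ p) + Multiset.replicate (X.count p / n) p

lemma count_divCount_self [DecidableEq P] (p : P) (n : ℕ) (X : Multiset P) :
    (divCount p n X).count p = X.count p / n := by
  rw [divCount, Multiset.count_add, Multiset.count_eq_zero_of_notMem (by simp),
    Multiset.count_replicate_self, zero_add]
  congr!

lemma count_divCount_of_ne [DecidableEq P] {p q : P} (hq : q ≠ p) (n : ℕ) (X : Multiset P) :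
    (divCount p n X).count q = X.count q := by
  simp [divCount, Multiset.count_replicate, hq, hq.symm]

/-- Division of the valuation at `p` by a common divisor `n` of its values. -/
def divValuation (φ : H →* FreeAb P) (p : P) (n : ℕ) (h : ∀ x, n ∣ valuation φ p x) :
    H →* FreeAb P where
  toFun a := Multiplicative.ofAdd (divCount p n (Multiplicative.toAdd (φ a)))
  map_one' := by
    rw [map_one]
    simp [divCount]
  map_mul' a b := by
    classical
    apply Multiplicative.toAdd.injective
    rw [toAdd_mul, toAdd_ofAdd, toAdd_ofAdd, toAdd_ofAdd, map_mul, toAdd_mul]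
    ext q
    rw [Multiset.count_add]
    by_cases hq : q = p
    · subst hq
      rw [count_divCount_self, count_divCount_self, count_divCount_self, Multiset.count_add]
      refine Nat.add_div_of_dvd_right ?_
      convert h a
      unfold valuation
      congr!
    · rw [count_divCount_of_ne hq, count_divCount_of_ne hq, count_divCount_of_ne hq,
        Multiset.count_add]

lemma valuation_divValuation_self {p : P} {n : ℕ} (h : ∀ x, n ∣ valuation φ p x) (a : H) :
    valuation (divValuation φ p n h) p a = valuation φ p a / n := by
  classical
  exact count_divCount_self _ _ _

lemma valuation_divValuation_of_ne {p q : P} (hq : q ≠ p) {n : ℕ}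
    (h : ∀ x, n ∣ valuation φ p x) (a : H) :
    valuation (divValuation φ p n h) q a = valuation φ q a := by
  classical
  exact count_divCount_of_ne hq _ _

lemma IsDivisorHom.divValuation (hφ : IsDivisorHom φ) {p : P} {n : ℕ}
    (h : ∀ x, n ∣ valuation φ p x) : IsDivisorHom (divValuation φ p n h) := by
  intro x y hxy
  rw [map_dvd_map_iff_valuation] at hxy
  refine hφ x y (map_dvd_map_iff_valuation.2 fun q => ?_)
  have hq := hxy q
  by_cases hqp : q = p
  · subst hqp
    rw [valuation_divValuation_self, valuation_divValuation_self] at hq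
    rw [← Nat.mul_div_cancel' (h x), ← Nat.mul_div_cancel' (h y)]
    exact Nat.mul_le_mul_left _ hq
  · rwa [valuation_divValuation_of_ne hqp, valuation_divValuation_of_ne hqp] at hq

lemma IsAmple.divValuation {a : H} (ha : IsAmple φ a) {p : P} {n : ℕ} (hn : 0 < n)
    (h : ∀ x, n ∣ valuation φ p x) : IsAmple (divValuation φ p n h) a := by
  classical
  intro X
  -- The multiplicity at `p` is scaled by `n` beforehand, so that dividing by `n` returns `X` plus
  -- the divided `Y`.
  obtain ⟨Y, hY, b, hb⟩ := ha (X.filter (· ≠ p) + Multiset.replicate (n * X.count p) p)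
  have hval : ∀ q, valuation φ q b =
      (X.filter (· ≠ p) + Multiset.replicate (n * X.count p) p + Y).count q := by
    intro q
    rw [valuation, hb]
    congr!
  have hXp : (X.filter (· ≠ p)).count p = 0 :=
    Multiset.count_filter_of_neg (p := (· ≠ p)) (by simp)
  have hbp : valuation φ p b = n * X.count p + Y.count p := by
    rw [hval, Multiset.count_add, Multiset.count_add, hXp, Multiset.count_replicate_self, zero_add]
  refine ⟨divCount p n Y, fun q hq => ?_, b, ?_⟩
  · have hqY : q ∈ Y := by
      unfold divCount at hq
      rcases Multiset.mem_add.1 hq with hq | hq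
      · exact Multiset.mem_of_mem_filter hq
      · rw [Multiset.mem_replicate] at hq
        obtain ⟨h0, rfl⟩ := hq
        refine Multiset.count_pos.1 (Nat.pos_of_ne_zero fun h1 => h0 ?_)
        simp only [h1, Nat.zero_div]
    have hqa := valuation_pos_iff.2 (hY q hqY)
    rw [← valuation_pos_iff]
    by_cases hqp : q = p
    · subst hqp
      rw [valuation_divValuation_self]
      exact Nat.div_pos (Nat.le_of_dvd hqa (h a)) hn
    · rwa [valuation_divValuation_of_ne hqp]
  · apply Multiplicative.toAdd.injective
    ext q
    rw [toAdd_ofAdd, Multiset.count_add]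
    have hdef : (Multiplicative.toAdd (KrullTransfer.divValuation φ p n h b)).count q =
        valuation (KrullTransfer.divValuation φ p n h) q b := by
      unfold valuation
      congr!
    rw [hdef]
    by_cases hqp : q = p
    · subst hqp
      rw [valuation_divValuation_self, hbp, count_divCount_self,
        Nat.add_div_of_dvd_right (dvd_mul_right _ _), Nat.mul_div_cancel_left _ hn]
    · rw [valuation_divValuation_of_ne hqp, hval, count_divCount_of_ne hqp, Multiset.count_add,
        Multiset.count_add, Multiset.count_filter_of_pos (p := (· ≠ p)) hqp,
        Multiset.count_replicate, if_neg (Ne.symm hqp), add_zero]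

lemma card_divValuation_lt {a : H} {p : P} {n : ℕ} (hn : 1 < n) (h : ∀ x, n ∣ valuation φ p x)
    (hp : 0 < valuation φ p a) :
    (Multiplicative.toAdd (divValuation φ p n h a)).card < (Multiplicative.toAdd (φ a)).card := by
  classical
  refine Multiset.card_lt_card (lt_of_le_of_ne (freeAb_dvd_iff.1 ?_) fun heq => ?_)
  · refine freeAb_dvd_iff.2 (Multiset.le_iff_count.2 fun q => ?_)
    by_cases hq : q = p
    · subst hq
      exact (count_divCount_self _ _ _).trans_le (Nat.div_le_self _ _)
    · exact (count_divCount_of_ne hq _ _).le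
  · have h1 := valuation_divValuation_self h a
    have h2 : valuation (KrullTransfer.divValuation φ p n h) p a = valuation φ p a := by
      unfold valuation
      rw [heq]
    have h3 := Nat.div_lt_self hp hn
    omega

/-- A divisor homomorphism with an ample element which is not a divisor theory can be simplified:
a prime is redundant or a valuation is not normalized. -/
lemma IsAmple.exists_card_lt (hφ : IsDivisorHom φ) {a : H} (ha : IsAmple φ a)
    (hn : ¬ IsDivisorTheory φ) : ∃ (Q : Type v) (ψ : H →* FreeAb Q), IsDivisorHom ψ ∧
      IsAmple ψ a ∧ (Multiplicative.toAdd (ψ a)).card < (Multiplicative.toAdd (φ a)).card := by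
  by_cases hsep : ∀ p q, q ≠ p → ∃ x : H, 0 < valuation φ q x ∧ valuation φ p x = 0
  · have hnorm : ¬ ∀ p, ∃ x y : H, valuation φ p x = valuation φ p y + 1 :=
      fun hnorm => hn (hφ.isDivisorTheory hsep hnorm)
    push Not at hnorm
    obtain ⟨p, hp⟩ := hnorm
    obtain ⟨n, hn1, hdvd⟩ : ∃ n, 1 < n ∧ ∀ x : H, n ∣ valuation φ p x := by
      by_contra! hcon
      obtain ⟨x, y, hxy⟩ := exists_valuation_eq_add_one (ha.exists_valuation_pos p) hcon
      exact hp x y hxy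
    refine ⟨P, _, hφ.divValuation hdvd, ha.divValuation (by omega) hdvd,
      card_divValuation_lt hn1 hdvd (Nat.pos_of_ne_zero fun h0 => ?_)⟩
    -- If `p` did not occur in `a`, then `Y` would avoid `p` and `b` would have value 1 at `p`,
    -- against the failure of normalization.
    obtain ⟨Y, hY, b, hb⟩ := ha {p}
    have hpY : p ∉ Y := fun hpY => (valuation_pos_iff.2 (hY p hpY)).ne' h0
    have hb1 : valuation φ p b = 1 := by
      classical
      rw [valuation, hb, toAdd_ofAdd, Multiset.count_add, Multiset.count_eq_zero_of_notMem hpY,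
        Multiset.count_singleton_self]
    exact hp b 1 (by rw [hb1, valuation_one])
  · push Not at hsep
    obtain ⟨p, q, hqp, hle⟩ := hsep
    refine ⟨_, _, hφ.dropPrime hqp (ha.exists_valuation_pos q)
      fun x hx => Nat.pos_of_ne_zero (hle x hx), ha.dropPrime p, card_dropPrime_lt ?_⟩
    -- Since `q` forces `p`, the prime `p` occurs in `b`; being different from `q` it lies in `Y`,
    -- hence among the primes of `a`.
    obtain ⟨Y, hY, b, hb⟩ := ha {q}
    have hqb : 0 < valuation φ q b := by
      rw [valuation_pos_iff, hb]
      simp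
    have hpb := valuation_pos_iff.1 (Nat.pos_of_ne_zero (hle b hqb))
    rw [hb, toAdd_ofAdd, Multiset.mem_add, Multiset.mem_singleton] at hpb
    exact hpb.elim (fun h => absurd h.symm hqp) (hY p)

lemma IsAmple.exists_divisorTheory (hφ : IsDivisorHom φ) {a : H} (ha : IsAmple φ a) :
    ∃ (Q : Type v) (ψ : H →* FreeAb Q), IsDivisorTheory ψ ∧ IsAmple ψ a ∧
      (Multiplicative.toAdd (ψ a)).card ≤ (Multiplicative.toAdd (φ a)).card := by
  suffices h : ∀ (n : ℕ) (P : Type v) (φ : H →* FreeAb P), IsDivisorHom φ → IsAmple φ a →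
      (Multiplicative.toAdd (φ a)).card = n → ∃ (Q : Type v) (ψ : H →* FreeAb Q),
        IsDivisorTheory ψ ∧ IsAmple ψ a ∧ (Multiplicative.toAdd (ψ a)).card ≤ n from
    h _ P φ hφ ha rfl
  intro n
  induction n using Nat.strong_induction_on with
  | _ n ih =>
    intro P φ hφ ha hn
    by_cases hdt : IsDivisorTheory φ
    · exact ⟨P, φ, hdt, ha, hn.le⟩
    · obtain ⟨Q, ψ, h1, h2, h3⟩ := ha.exists_card_lt hφ hdt
      obtain ⟨Q', ψ', h4, h5, h6⟩ := ih _ (hn ▸ h3) Q ψ h1 h2 rfl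
      exact ⟨Q', ψ', h4, h5, h6.trans (hn ▸ h3.le)⟩

end Valuation

/-! ### Ample elements and finitely generated class groups -/

section FG

variable {H : Type u} [CommMonoid H] {P : Type v} {φ : H →* FreeAb P}

lemma exists_le_toAdd_map {X : Multiset P} (hcof : ∀ p : P, ∃ h, gen p ∣ φ h) :
    ∃ h, X ≤ Multiplicative.toAdd (φ h) := by
  induction X using Multiset.induction with
  | empty => exact ⟨1, Multiset.zero_le _⟩
  | cons p X ih =>
    obtain ⟨h, hh⟩ := ih
    obtain ⟨h', hh'⟩ := hcof p
    refine ⟨h' * h, ?_⟩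
    rw [map_mul, toAdd_mul, ← Multiset.singleton_add]
    exact add_le_add (freeAb_dvd_iff.1 hh') hh

/-- A divisor `X` divides some `φ h`, and the cofactor represents the negative of its class; so
denominators can be removed. -/
lemma exists_cls_eq (hcof : ∀ p : P, ∃ h, gen p ∣ φ h) (g : ClassGrp φ) :
    ∃ X : Multiset P, cls φ (Multiplicative.ofAdd X) = g := by
  have hneg : ∀ X : Multiset P, ∃ Y : Multiset P,
      cls φ (Multiplicative.ofAdd Y) = - cls φ (Multiplicative.ofAdd X) := by
    intro X
    obtain ⟨h, hh⟩ := exists_le_toAdd_map (X := X) hcof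
    obtain ⟨Y, hY⟩ := Multiset.le_iff_exists_add.1 hh
    refine ⟨Y, ?_⟩
    rw [eq_neg_iff_add_eq_zero, ← cls_mul, mul_comm, ← ofAdd_add, ← hY, ofAdd_toAdd]
    exact (QuotientGroup.eq_one_iff _).2 (Subgroup.subset_closure ⟨_, ⟨h, rfl⟩, rfl⟩)
  obtain ⟨g, rfl⟩ := Additive.ofMul.surjective g
  obtain ⟨g, rfl⟩ := QuotientGroup.mk_surjective g
  induction g using Localization.induction_on with
  | _ xy =>
    obtain ⟨x, y⟩ := xy
    obtain ⟨Y, hY⟩ := hneg (Multiplicative.toAdd y.1)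
    refine ⟨Multiplicative.toAdd x + Y, ?_⟩
    rw [ofAdd_add, cls_mul, hY, ofAdd_toAdd, ofAdd_toAdd, ← sub_eq_add_neg, sub_eq_iff_eq_add]
    change Additive.ofMul (QuotientGroup.mk (Algebra.GrothendieckGroup.of x)) =
      Additive.ofMul (QuotientGroup.mk (Localization.mk x y * Algebra.GrothendieckGroup.of y.1))
    congr 2
    rw [Localization.mk_eq_monoidOf_mk']
    exact (Submonoid.LocalizationMap.mk'_spec _ x y).symm

/-- The classes of the finitely many primes of `a` generate: completing a divisor of class `-g` by
primes of `a` expresses `g` through them. -/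
lemma IsAmple.fg (hφ : IsDivisorHom φ) {a : H} (ha : IsAmple φ a) : AddGroup.FG (ClassGrp φ) := by
  classical
  refine ⟨⟨((Multiplicative.toAdd (φ a)).map fun p => cls φ (gen p)).toFinset, ?_⟩⟩
  rw [eq_top_iff]
  intro g _
  obtain ⟨X, hX⟩ := exists_cls_eq ha.exists_dvd (-g)
  obtain ⟨Y, hY, h, hh⟩ := ha X
  have h0 : cls φ (Multiplicative.ofAdd X) + cls φ (Multiplicative.ofAdd Y) = 0 := by
    rw [← cls_mul, ← ofAdd_add]
    exact (cls_eq_zero_iff hφ _).2 ⟨h, hh⟩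
  rw [hX, neg_add_eq_zero] at h0
  rw [h0, cls_ofAdd]
  refine AddSubgroup.multiset_sum_mem _ _ fun c hc => ?_
  obtain ⟨p, hp, rfl⟩ := Multiset.mem_map.1 hc
  refine AddSubgroup.subset_closure ?_
  rw [Finset.mem_coe, Multiset.mem_toFinset]
  exact Multiset.mem_map_of_mem _ (hY p hp)

lemma IsDivisorTheory.exists_dvd (hφ : IsDivisorTheory φ) (p : P) : ∃ h, gen p ∣ φ h := by
  obtain ⟨X, ⟨x, hx⟩, h, -⟩ := hφ.gcd p
  exact ⟨x, h x hx⟩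

lemma IsDivisorTheory.exists_isAmple (hφ : IsDivisorTheory φ) (hG : AddGroup.FG (ClassGrp φ)) :
    ∃ a, IsAmple φ a := by
  classical
  obtain ⟨S, hS⟩ := (AddMonoid.fg_def.1 (AddGroup.fg_iff_addMonoid_fg.1 hG))
  choose r hr using exists_cls_eq hφ.exists_dvd
  -- `S` generates the class group as a monoid, so any `a` containing representatives of all its
  -- members is ample: sums of generators need no subtraction of divisors.
  obtain ⟨a, ha⟩ := exists_le_toAdd_map (X := ∑ g ∈ S, r g) hφ.exists_dvd
  refine ⟨a, fun X => ?_⟩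
  have key : ∀ g : ClassGrp φ, ∃ Y : Multiset P,
      (∀ p ∈ Y, p ∈ Multiplicative.toAdd (φ a)) ∧ cls φ (Multiplicative.ofAdd Y) = g := by
    intro g
    have hg : g ∈ AddSubmonoid.closure (S : Set (ClassGrp φ)) := by
      rw [hS]
      trivial
    induction hg using AddSubmonoid.closure_induction with
    | mem g hg =>
      refine ⟨r g, fun p hp => Multiset.mem_of_le ha ?_, hr g⟩
      exact Multiset.mem_of_le (Finset.single_le_sum (fun _ _ => Multiset.zero_le _) hg) hp
    | zero => exact ⟨0, by simp, cls_one⟩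
    | add g g' _ _ h h' =>
      obtain ⟨Y, hY, rfl⟩ := h
      obtain ⟨Y', hY', rfl⟩ := h'
      exact ⟨Y + Y', fun p hp => (Multiset.mem_add.1 hp).elim (hY p) (hY' p), cls_mul _ _⟩
  obtain ⟨Y, hY, h⟩ := key (- cls φ (Multiplicative.ofAdd X))
  refine ⟨Y, hY, (cls_eq_zero_iff hφ.divisorHom _).1 ?_⟩
  rw [ofAdd_add, cls_mul, h, add_neg_cancel]

end FG

/-! ### Iteration of block homomorphisms -/

section Block

variable {H : Type u} [CommMonoid H] {P : Type u}

/-- The block homomorphism associated with a homomorphism into a free abelian monoid. -/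
def blockHom (φ : H →* FreeAb P) (hφ : IsDivisorHom φ) :
    H →* ZeroSum (Set.range fun p => cls φ (gen p)) where
  toFun a := ⟨Multiplicative.ofAdd
    ((Multiplicative.toAdd (φ a)).map (Set.rangeFactorization fun p => cls φ (gen p))), by
      change Multiset.sum _ = 0
      rw [toAdd_ofAdd, Multiset.map_map]
      refine (cls_ofAdd _).symm.trans ?_
      rw [ofAdd_toAdd]
      exact (cls_eq_zero_iff hφ _).2 ⟨a, rfl⟩⟩
  map_one' := by
    apply Subtype.ext
    change Multiplicative.ofAdd (Multiset.map _ _) = 1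
    rw [map_one]
    rfl
  map_mul' a b := by
    apply Subtype.ext
    change Multiplicative.ofAdd (Multiset.map _ _) =
      Multiplicative.ofAdd (Multiset.map _ _) * Multiplicative.ofAdd (Multiset.map _ _)
    rw [map_mul, toAdd_mul, Multiset.map_add, ofAdd_add]

lemma coe_blockHom (φ : H →* FreeAb P) (hφ : IsDivisorHom φ) (a : H) :
    (blockHom φ hφ a : FreeAb (Set.range fun p => cls φ (gen p))) = Multiplicative.ofAdd
      ((Multiplicative.toAdd (φ a)).map (Set.rangeFactorization fun p => cls φ (gen p))) := rfl

lemma IsDivisorTheory.isBlockHom {φ : H →* FreeAb P} (hφ : IsDivisorTheory φ) :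
    IsBlockHom (blockHom φ hφ.divisorHom) := by
  refine ⟨P, φ, AddEquiv.refl _, hφ, rfl, fun a => ?_⟩
  unfold terms
  rw [coe_blockHom, toAdd_ofAdd, Multiset.map_map]
  rfl

lemma card_blockHom (φ : H →* FreeAb P) (hφ : IsDivisorHom φ) (a : H) :
    (Multiplicative.toAdd (blockHom φ hφ a).1).card = (Multiplicative.toAdd (φ a)).card :=
  Multiset.card_map _ _

lemma IsAmple.blockHom {φ : H →* FreeAb P} {a : H} (ha : IsAmple φ a) (hφ : IsDivisorHom φ) :
    IsAmple (ZeroSum (Set.range fun p => cls φ (gen p))).subtype (blockHom φ hφ a) := by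
  intro X
  obtain ⟨X, rfl⟩ := Multiset.map_surjective_of_surjective
    (Set.rangeFactorization_surjective (f := fun p => cls φ (gen p))) X
  obtain ⟨Y, hY, h, hh⟩ := ha X
  refine ⟨Y.map (Set.rangeFactorization fun p => cls φ (gen p)), fun q hq => ?_,
    KrullTransfer.blockHom φ hφ h, ?_⟩
  · obtain ⟨p, hp, rfl⟩ := Multiset.mem_map.1 hq
    exact Multiset.mem_map_of_mem _ (hY p hp)
  · rw [Submonoid.coe_subtype, coe_blockHom, hh, toAdd_ofAdd, Multiset.map_add]

end Block

/-- Iterating block homomorphisms from a monoid of zero-sum sequences with an ample element leads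
to a monoid of zero-sum sequences whose inclusion is a divisor theory. -/
lemma exists_blockComposition_divisorTheory {H : Type u} [CommMonoid H] (n : ℕ) :
    ∀ {G : Type u} [AddCommGroup G] {G₀ : Set G} (θ : H →* ZeroSum G₀) (a : ZeroSum G₀),
      AddGroup.FG G → IsBlockComposition θ → ControlsArithmetic θ →
      IsAmple (ZeroSum G₀).subtype a → (Multiplicative.toAdd a.1).card = n →
      ∃ (G' : Type u) (_ : AddCommGroup G') (G₀' : Set G') (θ' : H →* ZeroSum G₀'),
        AddGroup.FG G' ∧ IsDivisorTheory (ZeroSum G₀').subtype ∧ IsBlockComposition θ' ∧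
          ControlsArithmetic θ' := by
  induction n using Nat.strong_induction_on with
  | _ n ih =>
    intro G _ G₀ θ a hG hθ hc ha hn
    by_cases hdt : IsDivisorTheory (ZeroSum G₀).subtype
    · exact ⟨G, inferInstance, G₀, θ, hG, hdt, hθ, hc⟩
    · obtain ⟨Q, ψ, hψ, haψ, hlt⟩ := ha.exists_card_lt isDivisorHom_subtype hdt
      obtain ⟨Q', ψ', hψ', haψ', hle⟩ := haψ.exists_divisorTheory hψ
      refine ih _ ?_ ((blockHom ψ' hψ'.divisorHom).comp θ) _ (haψ'.fg hψ'.divisorHom)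
        (.step θ _ hθ hψ'.isBlockHom) (hψ'.isBlockHom.controlsArithmetic.comp hc)
        (haψ'.blockHom hψ'.divisorHom) rfl
      rw [card_blockHom, ← hn]
      exact hle.trans_lt hlt

end
end KrullTransfer

open KrullTransfer
theorem theoremT {H P : Type u} [CancelCommMonoid H] (φ : H →* FreeAb P)
    (hφ : IsDivisorTheory φ) (hG : AddGroup.FG (ClassGrp φ)) :
    ∃ (G : Type u) (_ : AddCommGroup G) (G₀ : Set G) (θ : H →* ZeroSum G₀),
      AddGroup.FG G ∧
      IsDivisorTheory (ZeroSum G₀).subtype ∧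
      IsTransferHom θ ∧
      IsBlockComposition θ ∧
      lengthSystem H = lengthSystem (ZeroSum G₀) ∧
      catenaryDegree (ZeroSum G₀) ≤ catenaryDegree H ∧
      catenaryDegree H ≤ max (catenaryDegree (ZeroSum G₀)) 2 ∧
      (LocallyTame H ↔ LocallyTame (ZeroSum G₀)) := by
  obtain ⟨a, ha⟩ := hφ.exists_isAmple hG
  obtain ⟨G, _, G₀, θ, hG, hdt, hθ, hc⟩ := exists_blockComposition_divisorTheory _
    (blockHom φ hφ.divisorHom) _ hG (.base _ hφ.isBlockHom) hφ.isBlockHom.controlsArithmetic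
    (ha.blockHom hφ.divisorHom) rfl
  exact ⟨G, _, G₀, θ, hG, hdt, hc.transfer, hθ, hc.lengthSystem_eq, hc.catenaryDegree_le,
    hc.le_catenaryDegree, hc.locallyTame_iff⟩
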